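/- Let $dm(t)=\frac{t}{e^t-1}\,dt$ on $(0,\infty)$, and let $M$ be the multiplication operator $(M\varphi)(t)=e^{-t}\varphi(t)$ on $L_2(m)$. For $q\in\{0,1,2,\dots\}$ put $$(\mathcal L_q\varphi)(w)=\int_0^\infty e^{-tw}\,t^q\,\varphi(t)\,dm(t),\qquad \varphi\in L_2(m),\ \Re w>-\tfrac12 ,$$ and let $\mathcal H_{1,q}=\mathcal L_q[L_2(m)]$. The map $\mathcal L_q$ is injective, and $\mathcal H_{1,q}$ is the Hilbert space with inner product $(\mathcal L_q\varphi_1,\mathcal L_q\varphi_2)=\int_0^\infty\overline{\varphi_1}\,\varphi_2\,dm$. With $\Phi_n(x)=\frac1{x+n}$ and $\tau(x)=[1/x]$, let $$(\mathcal Q_{z,q}f)(x)=(-1)^q\sum_{n\ge1}z^{\tau(\Phi_n(x))}\,|\Phi_n'(x)|^{1+q}\,f(\Phi_n(x)),\qquad 0<x<1,$$ extended holomorphically to $\Re w>-\frac12$ as $(-1)^q\sum_{n\ge1}z^n(w+n)^{-2(1+q)}f\big(\frac1{w+n}\big)$. Let $J_p$ be the Bessel function of the first kind of order $p$. **Proposition.**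 Let $q\in\{0,1,2,\dots\}$. 1. The formula $(\mathcal B_q\varphi)(t)=\int_0^\infty \frac{J_{2q+1}(2\sqrt{st})}{\sqrt{st}}\,\varphi(s)\,dm(s)$ (with absolutely convergent integral) defines a bounded operator on $L_2(m)$. For $z\in\mathbb C\setminus(1,\infty)$ the operator $$\mathcal K_{z,q}=(-1)^q\,z\,(1-M)(1-zM)^{-1}\mathcal B_q$$ is a bounded operator on $L_2(m)$, where $(1-M)(1-zM)^{-1}$ is multiplication by $\frac{1-e^{-t}}{1-ze^{-t}}$ (the identity if $z=1$), and $1-zM$ has a bounded inverse if $z\neq1$. 2. For $|z|\le1$ and $f\in\mathcal H_{1,q}$ the series for $\mathcal Q_{z,q}f$ converges absolutely at every point and its sum lies in $\mathcal H_{1,q}$; this defines a bounded operator $\mathcal Q_{z,q}$ on $\mathcal H_{1,q}$. The function $z\mapsto\mathcal Q_{z,q}$ has an extension to bounded operators on $\mathcal H_{1,q}$ for all $z\in\mathbb C\setminus(1,\infty)$, which is analytic in the operator norm on the interior $\mathbb C\setminus[1,\infty)$ of this set and continuous in the operator norm on each sector $\{z:|\arg(1-z)|\le\theta\}$, $\theta<\pi$,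 with the vertex $z=1$ included. 3. For every $z\in\mathbb C\setminus(1,\infty)$ and $\varphi\in L_2(m)$, $$\mathcal Q_{z,q}\,\mathcal L_q[\varphi]=\mathcal L_q[\mathcal K_{z,q}\varphi],$$ and $\mathcal Q_{z,q}:\mathcal H_{1,q}\to\mathcal H_{1,q}$ and $\mathcal K_{z,q}:L_2(m)\to L_2(m)$ are both of trace class, that is, of the form $\sum_n(a_n,\cdot)\,b_n$ with $\sum_n\|a_n\|\,\|b_n\|<\infty$. -/

import Mathlib

open MeasureTheory Set Filter Topology
open scoped ENNReal ContDiff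

noncomputable section

namespace FareyGauss

/-- The measure `dm(t) = t / (e^t - 1) dt` on `(0, ∞)`. -/
def mMeas : Measure ℝ :=
  (volume.restrict (Ioi 0)).withDensity (fun t => ENNReal.ofReal (t / (Real.exp t - 1)))

/-- The Hilbert space `L₂(m)`. -/
abbrev L2m : Type := Lp ℂ 2 mMeas

lemma ae_mMeas_pos : ∀ᵐ t ∂mMeas, 0 < t :=
  (withDensity_absolutelyContinuous _ _).ae_le (ae_restrict_mem measurableSet_Ioi)

lemma density_le {t : ℝ} (ht : 0 < t) : t / (Real.exp t - 1) ≤ (1 + t) * Real.exp (-t) := by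
  have h1 : 0 < Real.exp t - 1 := by
    have := Real.add_one_lt_exp ht.ne'
    linarith
  rw [div_le_iff₀ h1]
  have h2 : Real.exp (-t) * Real.exp t = 1 := by rw [← Real.exp_add]; simp
  have h3 : (1 + t) * Real.exp (-t) ≤ 1 := by
    have := Real.add_one_le_exp t
    have h4 := Real.exp_pos (-t)
    nlinarith
  nlinarith

lemma integrable_pow_mul_exp (k : ℕ) {c : ℝ} (hc : c < 1) :
    Integrable (fun t : ℝ => t ^ k * Real.exp (c * t)) mMeas := by
  have hm : Measurable (fun t : ℝ => ENNReal.ofReal (t / (Real.exp t - 1))) := by fun_prop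
  rw [mMeas, integrable_withDensity_iff_integrable_smul' hm (by simp)]
  have hp : ∀ j : ℕ, IntegrableOn (fun t : ℝ => t ^ j * Real.exp (-((1 - c) * t))) (Ioi 0) := by
    intro j
    have h := integrableOn_rpow_mul_exp_neg_mul_rpow (s := j) (p := 1) (b := 1 - c)
      (by have : (0 : ℝ) ≤ j := Nat.cast_nonneg j
          linarith) one_pos (by linarith)
    refine h.congr_fun (fun t _ => ?_) measurableSet_Ioi
    simp only [Real.rpow_natCast, Real.rpow_one]
    rw [neg_mul]
  have hs : IntegrableOn (fun t : ℝ => t ^ k * Real.exp (-((1 - c) * t)) +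
      t ^ (k + 1) * Real.exp (-((1 - c) * t))) (Ioi 0) := (hp k).add (hp (k + 1))
  refine Integrable.mono' hs (by fun_prop) ?_
  filter_upwards [ae_restrict_mem measurableSet_Ioi] with t ht
  have ht : 0 < t := ht
  have h1 : 0 < Real.exp t - 1 := by
    have := Real.add_one_lt_exp ht.ne'
    linarith
  have h0 : 0 ≤ t / (Real.exp t - 1) := by positivity
  rw [ENNReal.toReal_ofReal h0, smul_eq_mul, Real.norm_of_nonneg (by positivity)]
  calc t / (Real.exp t - 1) * (t ^ k * Real.exp (c * t))
      ≤ ((1 + t) * Real.exp (-t)) * (t ^ k * Real.exp (c * t)) := by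
        gcongr
        exact density_le ht
    _ = (1 + t) * t ^ k * (Real.exp (-t) * Real.exp (c * t)) := by ring
    _ = _ := by
        rw [← Real.exp_add, show -t + c * t = -((1 - c) * t) by ring]
        ring

instance : IsFiniteMeasure mMeas := by
  have h := integrable_pow_mul_exp 0 (c := 0) (by norm_num)
  simp only [pow_zero, zero_mul, Real.exp_zero, mul_one] at h
  exact ((integrable_const_iff).1 h).resolve_left (by norm_num)

/-- The half plane `Re w > -1/2`. -/
abbrev HalfPlane : Type := {w : ℂ // -(1 / 2 : ℝ) < w.re}

lemma memLp_kernel (q : ℕ) (w : HalfPlane) :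
    MemLp (fun t : ℝ => Complex.exp (-(t * (w : ℂ))) * (t : ℂ) ^ q) 2 mMeas := by
  rw [memLp_two_iff_integrable_sq_norm (by fun_prop)]
  have h := integrable_pow_mul_exp (2 * q) (c := -2 * (w : ℂ).re) (by have := w.2; linarith)
  refine h.congr (.of_forall fun t => ?_)
  simp only [norm_mul, Complex.norm_exp, norm_pow, Complex.norm_real, mul_pow]
  rw [← Real.exp_nat_mul, ← pow_mul, mul_comm q 2, pow_mul, pow_mul, Real.norm_eq_abs, sq_abs,
    mul_comm]
  congr 2
  simp
  ring

lemma integrable_kernel (q : ℕ) (w : HalfPlane) (φ : L2m) :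
    Integrable (fun t : ℝ => Complex.exp (-(t * (w : ℂ))) * (t : ℂ) ^ q * φ t) mMeas :=
  (memLp_kernel q w).integrable_mul (Lp.memLp φ)

/-- The generalized Laplace transform `(L_q φ)(w) = ∫ e^{-tw} t^q φ(t) dm(t)`, `Re w > -1/2`. -/
def laplace (q : ℕ) : L2m →ₗ[ℂ] (HalfPlane → ℂ) where
  toFun φ w := ∫ t : ℝ, Complex.exp (-(t * (w : ℂ))) * (t : ℂ) ^ q * φ t ∂mMeas
  map_add' φ ψ := by
    funext w
    rw [Pi.add_apply, ← integral_add (integrable_kernel q w φ) (integrable_kernel q w ψ)]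
    refine integral_congr_ae ?_
    filter_upwards [Lp.coeFn_add φ ψ] with t ht
    rw [ht, Pi.add_apply]
    ring
  map_smul' c φ := by
    funext w
    rw [Pi.smul_apply, RingHom.id_apply, smul_eq_mul, ← integral_const_mul]
    refine integral_congr_ae ?_
    filter_upwards [Lp.coeFn_smul c φ] with t ht
    rw [ht, Pi.smul_apply, smul_eq_mul]
    ring

lemma laplace_injective (q : ℕ) : Function.Injective (laplace q) := by
  rw [injective_iff_map_eq_zero]
  intro φ hφ
  have hint : Integrable (fun t : ℝ => (t : ℂ) ^ q * φ t) mMeas := by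
    simpa using integrable_kernel q ⟨0, by norm_num⟩ φ
  have hz : ∀ ξ : ℝ, VectorFourier.fourierIntegral Real.fourierChar mMeas (innerₗ ℝ)
      (fun t : ℝ => (t : ℂ) ^ q * φ t) ξ = 0 := by
    intro ξ
    have := congrFun hφ ⟨2 * Real.pi * ξ * Complex.I, by simp⟩
    rw [← show _ = (0 : ℂ) from this]
    simp only [laplace, LinearMap.coe_mk, AddHom.coe_mk, VectorFourier.fourierIntegral]
    congr 1
    funext t
    rw [Circle.smul_def, Real.fourierChar_apply, smul_eq_mul, ← mul_assoc]
    congr 3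
    simp
    ring
  have hae : ∀ᵐ t : ℝ ∂mMeas, (t : ℂ) ^ q * φ t = 0 := by
    refine ae_eq_zero_of_integral_contDiff_smul_eq_zero hint.locallyIntegrable ?_
    intro g hg hgs
    let G : SchwartzMap ℝ ℂ := HasCompactSupport.toSchwartzMap (f := fun x => (g x : ℂ))
      (hgs.comp_left (g := fun x : ℝ => (x : ℂ)) rfl)
      (Complex.ofRealCLM.contDiff.comp hg)
    have hGg : ∀ x, G x = (g x : ℂ) := fun _ => rfl
    let F : SchwartzMap ℝ ℂ := FourierTransformInv.fourierInv G
    have h := VectorFourier.integral_fourierIntegral_smul_eq_flip (μ := mMeas)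
      (ν := (volume : Measure ℝ)) (L := innerₗ ℝ)
      (f := fun t : ℝ => (t : ℂ) ^ q * φ t) (g := (F : ℝ → ℂ)) Real.continuous_fourierChar
      (by simp only [innerₗ_apply_apply]; exact continuous_inner) hint F.integrable
    simp only [hz, zero_smul, integral_zero] at h
    rw [h]
    refine integral_congr_ae (.of_forall fun t => ?_)
    have h2 : VectorFourier.fourierIntegral Real.fourierChar volume (innerₗ ℝ).flip
        (F : ℝ → ℂ) t = G t := by
      rw [flip_innerₗ]
      have : FourierTransform.fourier F = G := FourierTransform.fourier_fourierInv_eq G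
      rw [← this]
      rfl
    simp only [h2, hGg, smul_eq_mul, Complex.real_smul]
    ring
  rw [Lp.eq_zero_iff_ae_eq_zero]
  filter_upwards [hae, ae_mMeas_pos] with t ht h0
  have : (t : ℂ) ≠ 0 := by exact_mod_cast h0.ne'
  simpa [this] using ht

/-- The space `H_{1,q}` of all functions on `Re w > -1/2` of the form `L_q φ`, `φ ∈ L₂(m)`. -/
def H1 (q : ℕ) : Type := ↥(LinearMap.range (laplace q))

namespace H1

variable {q : ℕ}

instance : AddCommGroup (H1 q) := inferInstanceAs (AddCommGroup ↥(LinearMap.range (laplace q)))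

instance : Module ℂ (H1 q) := inferInstanceAs (Module ℂ ↥(LinearMap.range (laplace q)))

instance : CoeFun (H1 q) (fun _ => HalfPlane → ℂ) := ⟨fun f => f.1⟩

end H1

/-- `L_q` as a bijection from `L₂(m)` onto `H_{1,q}`. -/
def laplaceEquivₗ (q : ℕ) : L2m ≃ₗ[ℂ] H1 q :=
  LinearEquiv.ofInjective (laplace q) (laplace_injective q)

namespace H1

variable {q : ℕ}

instance : NormedAddCommGroup (H1 q) :=
  NormedAddCommGroup.induced (H1 q) L2m (laplaceEquivₗ q).symm.toLinearMap
    (laplaceEquivₗ q).symm.injective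

instance : NormedSpace ℂ (H1 q) :=
  NormedSpace.induced ℂ (H1 q) L2m (laplaceEquivₗ q).symm.toLinearMap

/-- The inner product `(L_q φ₁, L_q φ₂) = ∫ conj φ₁ φ₂ dm`. -/
instance : InnerProductSpace ℂ (H1 q) where
  inner f g := inner ℂ ((laplaceEquivₗ q).symm f) ((laplaceEquivₗ q).symm g)
  norm_sq_eq_re_inner f := norm_sq_eq_re_inner (𝕜 := ℂ) ((laplaceEquivₗ q).symm f)
  conj_inner_symm f g := inner_conj_symm (𝕜 := ℂ) _ _
  add_left f g h := by rw [map_add, inner_add_left]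
  smul_left f g c := by rw [map_smul, inner_smul_left]

end H1

/-- `L_q` as a unitary map from `L₂(m)` onto `H_{1,q}`. -/
def laplaceEquiv (q : ℕ) : L2m ≃ₗᵢ[ℂ] H1 q :=
  { laplaceEquivₗ q with
    norm_map' := fun φ => by
      change ‖(laplaceEquivₗ q).symm (laplaceEquivₗ q φ)‖ = ‖φ‖
      rw [LinearEquiv.symm_apply_apply] }

lemma laplaceEquiv_apply (q : ℕ) (φ : L2m) (w : HalfPlane) :
    laplaceEquiv q φ w =
      ∫ t : ℝ, Complex.exp (-(t * (w : ℂ))) * (t : ℂ) ^ q * φ t ∂mMeas := rfl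

instance (q : ℕ) : CompleteSpace (H1 q) :=
  (laplaceEquiv q).symm.toIsometryEquiv.completeSpace

/-- The inverse branches `Φ_n(x) = 1 / (x + n)` of the Gauss map on the unit interval. -/
def branch (n : ℕ) (x : ℝ) : ℝ := 1 / (x + n)

/-- The first passage time `τ(x) = [1 / x]`. -/
def passageTime (x : ℝ) : ℕ := ⌊1 / x⌋₊

/-- The branches `Φ_{n+1}(w) = 1 / (w + n + 1)` on the half plane. -/
def branchC (n : ℕ) (w : HalfPlane) : HalfPlane :=
  ⟨1 / ((w : ℂ) + (n + 1 : ℕ)), by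
    have h : 0 < ((w : ℂ) + (n + 1 : ℕ)).re := by
      have := w.2
      have h0 : (0 : ℝ) ≤ n := Nat.cast_nonneg n
      simp
      linarith
    have h2 : 0 ≤ (1 / ((w : ℂ) + (n + 1 : ℕ))).re := by
      rw [one_div, Complex.inv_re]
      exact div_nonneg h.le (Complex.normSq_nonneg _)
    linarith⟩

/-- A point of the unit interval, as a point of the half plane. -/
def ofUnit (x : ℝ) (hx : x ∈ Ioo (0 : ℝ) 1) : HalfPlane :=
  ⟨x, by rw [Complex.ofReal_re]; linarith [hx.1]⟩

lemma branch_mem (n : ℕ) {x : ℝ} (hx : x ∈ Ioo (0 : ℝ) 1) :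
    branch (n + 1) x ∈ Ioo (0 : ℝ) 1 := by
  have h0 : (0 : ℝ) ≤ n := Nat.cast_nonneg n
  have h1 := hx.1
  have h : 1 < x + (n + 1 : ℕ) := by push_cast; linarith
  exact ⟨by unfold branch; positivity, by
    unfold branch
    rw [div_lt_one (by linarith)]
    exact h⟩

/-- `g = Q_{z,q} f`, with an absolutely convergent series: on the unit interval
`g(x) = (-1)^q ∑_{n ≥ 1} z^{τ(Φ_n(x))} |Φ_n'(x)|^{1+q} f(Φ_n(x))`, and on the whole half plane `g`
is given by the holomorphic extension of this series, in which `z^{τ(Φ_n(x))} = z^n` and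
`|Φ_n'(x)|` is continued as `(w + n)^{-2}`. -/
def IsTransfer (q : ℕ) (z : ℂ) (f g : HalfPlane → ℂ) : Prop :=
  (∀ (x : ℝ) (hx : x ∈ Ioo (0 : ℝ) 1),
    HasSum (fun n : ℕ => (-1 : ℂ) ^ q * (z ^ passageTime (branch (n + 1) x) *
      ((|deriv (branch (n + 1)) x| ^ (1 + q) : ℝ) : ℂ) *
        f (ofUnit (branch (n + 1) x) (branch_mem n hx)))) (g (ofUnit x hx))) ∧
  ∀ w : HalfPlane,
    HasSum (fun n : ℕ => (-1 : ℂ) ^ q * (z ^ (n + 1) *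
      (1 / ((w : ℂ) + (n + 1 : ℕ)) ^ 2) ^ (1 + q) * f (branchC n w))) (g w)

/-- The Bessel function of the first kind of integer order `p ≥ 0`, on the real line. -/
def besselJ (p : ℕ) (x : ℝ) : ℝ :=
  ∑' k : ℕ, (-1 : ℝ) ^ k / ((k.factorial : ℝ) * ((k + p).factorial : ℝ)) * (x / 2) ^ (2 * k + p)

/-- The kernel `J_{2q+1}(2 √(st)) / √(st)`. -/
def besselKernel (q : ℕ) (s t : ℝ) : ℝ :=
  besselJ (2 * q + 1) (2 * √(s * t)) / √(s * t)

/-- The function `e^{-t}` as an element of `L_∞(m)`. -/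
def expNegLp : Lp ℂ ∞ mMeas :=
  MemLp.toLp (fun t : ℝ => Complex.exp (-(t : ℂ))) <| by
    refine memLp_top_of_bound (by fun_prop) 1 ?_
    filter_upwards [ae_mMeas_pos] with t ht
    rw [Complex.norm_exp]
    simpa using ht.le

/-- The multiplication operator `(M φ)(t) = e^{-t} φ(t)` on `L₂(m)`. -/
def mulM : L2m →L[ℂ] L2m :=
  (ContinuousLinearMap.mul ℂ ℂ).holderL mMeas ∞ 2 2 expNegLp

lemma mulM_apply (φ : L2m) : ∀ᵐ t ∂mMeas, mulM φ t = Complex.exp (-(t : ℂ)) * φ t := by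
  have h1 := (ContinuousLinearMap.mul ℂ ℂ).coeFn_holder (r := 2) expNegLp φ
  have h2 : (expNegLp : ℝ → ℂ) =ᵐ[mMeas] fun t : ℝ => Complex.exp (-(t : ℂ)) :=
    MemLp.coeFn_toLp _
  filter_upwards [h1, h2] with t ht1 ht2
  change (ContinuousLinearMap.mul ℂ ℂ).holder 2 expNegLp φ t = _
  rw [ht1, ht2]
  rfl

/-- Trace class (nuclear) operators on a Hilbert space: `T = ∑ ⟨aₙ, ·⟩ bₙ` with
`∑ ‖aₙ‖ ‖bₙ‖ < ∞`. -/
def IsTraceClass {H : Type*} [NormedAddCommGroup H] [InnerProductSpace ℂ H]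
    (T : H →L[ℂ] H) : Prop :=
  ∃ a b : ℕ → H, Summable (fun n => ‖a n‖ * ‖b n‖) ∧
    ∀ x : H, HasSum (fun n => inner ℂ (a n) x • b n) (T x)

/-- The plane cut along the open ray `(1, ∞)`. -/
def cutPlane : Set ℂ := {z | ¬ (1 < z.re ∧ z.im = 0)}

/-- The interior of `cutPlane`: the plane cut along the closed ray `[1, ∞)`. -/
def openCutPlane : Set ℂ := {z | ¬ (1 ≤ z.re ∧ z.im = 0)}

end FareyGauss

end

noncomputable section

namespace FareyGauss

/-! ### The product expansion of the Bessel kernel -/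

/-! Everything rests on one nuclear expansion of the Bessel kernel. Multiplying the Laguerre
generating function by `e^{-3t}` writes the kernel as a series of products of a Laguerre polynomial
in `s/3` and `(3t)^n e^{-3t}` (`hasSum_besselF_laguerre`). The Sonin-type energy bound
`abs_laguerre_le` and the estimate `abs_rightFactor_le` dominate the n-th product by `(9/10)^n`
times `weight q s * weight q t`, with a weight in `L₂(m)`. Hence `B_q` is a norm-convergent series
of rank one operators with summable norms, and this survives composition with any bounded operator.

The conjugacy comes from a Laplace transform: against `e^{-tu} t^q (e^t - 1) dm(t)` the kernel
integrates to `u^{-2(q+1)} e^{-s/u} s^q` (`integral_cexp_mul_besselKernel`). For `u = w + n` this is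
one branch of the transfer operator. Summing over `n` with weights `z^n` is a geometric series in `z
e^{-t}`, whose sum is `z (1 - e^{-t}) / (1 - z e^{-t})` (`hasSum_multiplier`). This proves the
identity for `|z| ≤ 1`; elsewhere in the cut plane `Q` is taken to be the conjugate of `K`, so its
regularity in `z` is inherited from `K`.

Analyticity off the closed ray is that of inversion in a Banach algebra. At `z = 1` the operator `1
- M` has no bounded inverse, but the quotient of the two factors is bounded by `1 / cos(arg(1 - z) /
2)`, uniformly on sectors (`norm_multiplier_le`). It converges to the identity only strongly; the
nuclear series of `B_q` upgrades this to norm convergence (`tendsto_transferL2`). -/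

open Polynomial in
/-- The Laguerre polynomial `L_n^{(p)}`, divided by `(n + p)!`. -/
def laguerre (p n : ℕ) : ℝ[X] :=
  ∑ k ∈ Finset.range (n + 1),
    monomial k ((-1 : ℝ) ^ k / (k.factorial * (k + p).factorial * (n - k).factorial))

lemma laguerre_coeff (p n k : ℕ) : (laguerre p n).coeff k =
    if k ≤ n then (-1 : ℝ) ^ k / (k.factorial * (k + p).factorial * (n - k).factorial) else 0 := by
  simp only [laguerre, Polynomial.finsetSum_coeff, Polynomial.coeff_monomial]
  simp

lemma laguerre_eval (p n : ℕ) (x : ℝ) : (laguerre p n).eval x =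
    ∑ k ∈ Finset.range (n + 1),
      (-1 : ℝ) ^ k / (k.factorial * (k + p).factorial * (n - k).factorial) * x ^ k := by
  simp [laguerre, Polynomial.eval_finsetSum]

/-- The Laguerre differential equation, read off coefficient by coefficient. -/
lemma laguerre_coeff_succ (p n k : ℕ) :
    ((k : ℝ) + 1) * (k + p + 1) * (laguerre p n).coeff (k + 1) =
      ((k : ℝ) - n) * (laguerre p n).coeff k := by
  simp only [laguerre_coeff]
  rcases lt_trichotomy k n with h | h | h
  · obtain ⟨j, rfl⟩ : ∃ j, n = k + 1 + j := ⟨n - (k + 1), by omega⟩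
    rw [if_pos (by omega), if_pos (by omega), show k + 1 + j - (k + 1) = j by omega,
      show k + 1 + j - k = j + 1 by omega, show k + 1 + p = (k + p) + 1 by omega]
    simp only [Nat.factorial_succ]
    push_cast
    have h1 := Nat.factorial_pos k
    have h2 := Nat.factorial_pos (k + p)
    have h3 := Nat.factorial_pos j
    field_simp
    ring
  · subst h
    simp
  · rw [if_neg (by omega), if_neg (by omega)]
    simp

lemma laguerre_ode (p n : ℕ) (x : ℝ) :
    x * (laguerre p n).derivative.derivative.eval x +
      (p + 1 - x) * (laguerre p n).derivative.eval x + n * (laguerre p n).eval x = 0 := by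
  have h : Polynomial.X * (laguerre p n).derivative.derivative +
      (Polynomial.C ((p : ℝ) + 1) * (laguerre p n).derivative -
        Polynomial.X * (laguerre p n).derivative) +
      Polynomial.C (n : ℝ) * (laguerre p n) = 0 := by
    ext k
    have hk := laguerre_coeff_succ p n k
    rcases k with _ | k
    · simp [Polynomial.coeff_derivative] at hk ⊢
      linarith
    · simp only [Polynomial.coeff_add, Polynomial.coeff_sub, Polynomial.coeff_X_mul,
        Polynomial.coeff_C_mul, Polynomial.coeff_derivative, Polynomial.coeff_zero]
      push_cast at hk ⊢
      linarith
  have := congrArg (Polynomial.eval x) h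
  simp only [Polynomial.eval_add, Polynomial.eval_sub, Polynomial.eval_mul, Polynomial.eval_X,
    Polynomial.eval_C, Polynomial.eval_zero] at this
  linarith

lemma laguerre_eval_zero (p n : ℕ) :
    (laguerre p n).eval 0 = 1 / (p.factorial * n.factorial) := by
  rw [← Polynomial.coeff_zero_eq_eval_zero, laguerre_coeff]
  simp

/-- The energy `(n P² + x P'²) e^{-2x}` decreases on `[0, ∞)`, so it stays below its value at 0,
where the second term vanishes. -/
lemma abs_laguerre_le (p n : ℕ) {x : ℝ} (hx : 0 ≤ x) :
    |(laguerre p n).eval x| ≤ Real.exp x / (p.factorial * n.factorial) := by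
  have hc : (0 : ℝ) < p.factorial * n.factorial := by
    have h1 := Nat.factorial_pos p
    have h2 := Nat.factorial_pos n
    positivity
  -- For `n = 0` the energy does not control `P`; there `P` is constant.
  rcases Nat.eq_zero_or_pos n with rfl | hn
  · rw [laguerre_eval]
    simp only [zero_add, Finset.range_one, Finset.sum_singleton, pow_zero, mul_one,
      Nat.factorial_zero, Nat.cast_one, one_mul] at hc ⊢
    rw [abs_of_nonneg (by positivity)]
    simp only [Nat.sub_zero, Nat.factorial_zero, Nat.cast_one, mul_one]
    gcongr
    exact Real.one_le_exp hx
  set P := laguerre p n with hP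
  let E : ℝ → ℝ := fun x => (n * P.eval x ^ 2 + x * P.derivative.eval x ^ 2) * Real.exp (-2 * x)
  have hE : ∀ x, HasDerivAt E ((n * (2 * P.eval x * P.derivative.eval x) +
      (1 * P.derivative.eval x ^ 2 +
        x * (2 * P.derivative.eval x * P.derivative.derivative.eval x))) * Real.exp (-2 * x) +
      (n * P.eval x ^ 2 + x * P.derivative.eval x ^ 2) * (Real.exp (-2 * x) * (-2 * 1))) x := by
    intro x
    have h0 := (P.hasDerivAt x).pow 2
    have h1 := (P.derivative.hasDerivAt x).pow 2
    have h2 := ((hasDerivAt_id x).const_mul (-2)).exp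
    have h3 := ((h0.const_mul (n : ℝ)).add ((hasDerivAt_id x).mul h1)).mul h2
    refine h3.congr_deriv ?_
    simp
  have hanti : AntitoneOn E (Ici 0) := by
    refine antitoneOn_of_deriv_nonpos (convex_Ici 0)
      (fun x _ => (hE x).continuousAt.continuousWithinAt)
      (fun x _ => (hE x).differentiableAt.differentiableWithinAt) ?_
    intro x _
    rw [(hE x).deriv]
    have hode := laguerre_ode p n x
    rw [← hP] at hode
    -- Eliminating `x P''` by the differential equation cancels the terms in `P P'` and `x P'²`,
    -- leaving a negative definite remainder.
    have hx2 : x * P.derivative.derivative.eval x =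
      -((p + 1 - x) * P.derivative.eval x) - n * P.eval x := by linarith
    have : (n * (2 * P.eval x * P.derivative.eval x) +
      (1 * P.derivative.eval x ^ 2 +
        x * (2 * P.derivative.eval x * P.derivative.derivative.eval x))) * Real.exp (-2 * x) +
      (n * P.eval x ^ 2 + x * P.derivative.eval x ^ 2) * (Real.exp (-2 * x) * (-2 * 1)) =
      -(((2 * p + 1) * P.derivative.eval x ^ 2 + 2 * n * P.eval x ^ 2) * Real.exp (-2 * x)) := by
      rw [show x * (2 * P.derivative.eval x * P.derivative.derivative.eval x) =
        2 * P.derivative.eval x * (x * P.derivative.derivative.eval x) by ring, hx2]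
      ring
    rw [this]
    have : 0 ≤ ((2 * p + 1) * P.derivative.eval x ^ 2 + 2 * n * P.eval x ^ 2) *
      Real.exp (-2 * x) := by positivity
    linarith
  have h := hanti self_mem_Ici hx hx
  simp only [E] at h
  rw [hP, laguerre_eval_zero, ← hP] at h
  have hn' : (0 : ℝ) < n := by exact_mod_cast hn
  have he : Real.exp (-2 * x) * Real.exp x ^ 2 = 1 := by
    rw [← Real.exp_nat_mul, ← Real.exp_add]
    simp
  have h5 : P.eval x ^ 2 * Real.exp (-2 * x) ≤ (1 / (p.factorial * n.factorial : ℝ)) ^ 2 := by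
    have h6 : 0 ≤ x * P.derivative.eval x ^ 2 * Real.exp (-2 * x) := by positivity
    refine le_of_mul_le_mul_left ?_ hn'
    simp only [mul_zero, Real.exp_zero, mul_one, zero_mul, add_zero] at h
    linarith
  refine abs_le_of_sq_le_sq ?_ (by positivity)
  calc P.eval x ^ 2 = P.eval x ^ 2 * Real.exp (-2 * x) * Real.exp x ^ 2 := by
        rw [mul_assoc, he, mul_one]
    _ ≤ (1 / (p.factorial * n.factorial : ℝ)) ^ 2 * Real.exp x ^ 2 := by gcongr
    _ = _ := by ring

/-- The entire function `∑ (-1)^k y^k / (k! (k+p)!)`, equal to `y^{-p/2} J_p(2√y)`. -/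
def besselF (p : ℕ) (y : ℝ) : ℝ :=
  ∑' k : ℕ, (-1 : ℝ) ^ k / (k.factorial * (k + p).factorial) * y ^ k

lemma norm_besselF_term_le (p k : ℕ) (y : ℝ) :
    ‖(-1 : ℝ) ^ k / (k.factorial * (k + p).factorial) * y ^ k‖ ≤ |y| ^ k / k.factorial := by
  have h1 : (0 : ℝ) < k.factorial := by exact_mod_cast Nat.factorial_pos k
  have h2 : (1 : ℝ) ≤ (k + p).factorial := by exact_mod_cast Nat.factorial_pos (k + p)
  rw [norm_mul, norm_div, norm_pow, norm_pow, norm_neg, norm_one, one_pow, Real.norm_eq_abs,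
    Real.norm_eq_abs, abs_of_pos (by positivity), one_div_mul_eq_div]
  gcongr
  exact le_mul_of_one_le_right h1.le h2

lemma summable_norm_besselF (p : ℕ) (y : ℝ) :
    Summable fun k : ℕ => ‖(-1 : ℝ) ^ k / (k.factorial * (k + p).factorial) * y ^ k‖ :=
  (Real.summable_pow_div_factorial |y|).of_nonneg_of_le (fun _ => norm_nonneg _)
    fun k => norm_besselF_term_le p k y

lemma hasSum_besselF (p : ℕ) (y : ℝ) :
    HasSum (fun k : ℕ => (-1 : ℝ) ^ k / (k.factorial * (k + p).factorial) * y ^ k)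
      (besselF p y) :=
  (summable_norm_besselF p y).of_norm.hasSum

lemma measurable_besselF (p : ℕ) : Measurable (besselF p) := by
  refine measurable_of_tendsto_metrizable (f := fun n y => ∑ k ∈ Finset.range n,
    (-1 : ℝ) ^ k / (k.factorial * (k + p).factorial) * y ^ k) (fun n => by fun_prop) ?_
  rw [tendsto_pi_nhds]
  exact fun y => (hasSum_besselF p y).tendsto_sum_nat

/-- The order `2q + 1` is odd, so division by `√(st)` leaves only even powers of the root. -/
lemma besselKernel_eq (q : ℕ) {s t : ℝ} (hs : 0 < s) (ht : 0 < t) :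
    besselKernel q s t = (s * t) ^ q * besselF (2 * q + 1) (s * t) := by
  have hst : 0 < s * t := mul_pos hs ht
  have hr : 0 < √(s * t) := Real.sqrt_pos.2 hst
  rw [besselKernel, besselJ, besselF, ← tsum_div_const, ← tsum_mul_left]
  congr 1
  funext k
  have h : √(s * t) ^ 2 = s * t := Real.sq_sqrt hst.le
  rw [mul_div_cancel_left₀ _ (two_ne_zero), show 2 * k + (2 * q + 1) = 2 * (k + q) + 1 by ring,
    pow_succ, pow_mul, h, ← mul_assoc, mul_div_cancel_right₀ _ hr.ne']
  ring

/-- The Cauchy product of the series of `besselF p (s * t)` and of `e^{3t}` has the Laguerre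
polynomials in `s/3` as coefficients of `(3t)^n`. The scale 3 splits the growth so that both factors
are at most of order `e^{x/3}`, up to powers. -/
lemma hasSum_besselF_laguerre (p : ℕ) (s t : ℝ) :
    HasSum (fun n : ℕ => (laguerre p n).eval (s / 3) * ((3 * t) ^ n * Real.exp (-(3 * t))))
      (besselF p (s * t)) := by
  have hexp : Summable fun j : ℕ => ‖(3 * t) ^ j / (j.factorial : ℝ)‖ := by
    simpa [abs_mul] using Real.summable_pow_div_factorial |3 * t|
  have hsum := (summable_norm_sum_mul_antidiagonal_of_summable_norm
    (summable_norm_besselF p (s * t)) hexp).of_norm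
  have htsum := tsum_mul_tsum_eq_tsum_sum_antidiagonal_of_summable_norm
    (summable_norm_besselF p (s * t)) hexp
  have hh := hsum.hasSum
  rw [← htsum] at hh
  have he : ∑' j : ℕ, (3 * t) ^ j / (j.factorial : ℝ) = Real.exp (3 * t) := by
    rw [Real.exp_eq_exp_ℝ, NormedSpace.exp_eq_tsum_div]
  rw [he] at hh
  have h2 := hh.mul_right (Real.exp (-(3 * t)))
  rw [mul_assoc, ← Real.exp_add, add_neg_cancel, Real.exp_zero, mul_one] at h2
  refine h2.congr_fun ?_
  intro n
  rw [laguerre_eval, ← mul_assoc]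
  congr 1
  rw [Finset.Nat.sum_antidiagonal_eq_sum_range_succ
    (fun k j => (-1 : ℝ) ^ k / (k.factorial * (k + p).factorial) * (s * t) ^ k *
      ((3 * t) ^ j / (j.factorial : ℝ))), Finset.sum_mul]
  refine Finset.sum_congr rfl fun k hk => ?_
  obtain ⟨j, rfl⟩ : ∃ j, n = k + j := ⟨n - k, by rw [Finset.mem_range] at hk; omega⟩
  rw [Nat.add_sub_cancel_left, pow_add, div_pow, mul_pow 3 t k, mul_pow s t k]
  have h1 := Nat.factorial_pos k
  have h2 := Nat.factorial_pos (k + p)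
  have h3 := Nat.factorial_pos j
  field_simp

/-- The weight `t^q e^{t/3}`. -/
def weight (q : ℕ) (t : ℝ) : ℝ := t ^ q * Real.exp (t / 3)

/-- The left factors in the expansion of the Bessel kernel into products. -/
def leftFactor (q n : ℕ) (s : ℝ) : ℝ :=
  n.factorial * (s ^ q * (laguerre (2 * q + 1) n).eval (s / 3))

/-- The right factors in the expansion of the Bessel kernel into products. -/
def rightFactor (q n : ℕ) (t : ℝ) : ℝ :=
  t ^ q * ((3 * t) ^ n * Real.exp (-(3 * t))) / n.factorial

lemma measurable_weight (q : ℕ) : Measurable (weight q) := by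
  unfold weight; fun_prop

lemma measurable_leftFactor (q n : ℕ) : Measurable (leftFactor q n) := by
  unfold leftFactor
  have := (laguerre (2 * q + 1) n).continuous.measurable
  fun_prop

lemma measurable_rightFactor (q n : ℕ) : Measurable (rightFactor q n) := by
  unfold rightFactor; fun_prop

lemma weight_nonneg (q : ℕ) {t : ℝ} (ht : 0 ≤ t) : 0 ≤ weight q t := by
  unfold weight; positivity

lemma abs_leftFactor_le (q n : ℕ) {s : ℝ} (hs : 0 ≤ s) : |leftFactor q n s| ≤ weight q s := by
  have h1 : (0 : ℝ) < n.factorial := by exact_mod_cast Nat.factorial_pos n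
  have h2 : (1 : ℝ) ≤ (2 * q + 1).factorial := by exact_mod_cast Nat.factorial_pos (2 * q + 1)
  have h := abs_laguerre_le (2 * q + 1) n (x := s / 3) (by positivity)
  rw [leftFactor, abs_mul, abs_mul, abs_of_pos h1, abs_of_nonneg (pow_nonneg hs q), weight]
  calc _ ≤ n.factorial * (s ^ q * (Real.exp (s / 3) / ((2 * q + 1).factorial * n.factorial))) := by
        gcongr
    _ = s ^ q * (Real.exp (s / 3) / (2 * q + 1).factorial) := by field_simp
    _ ≤ _ := by
        gcongr
        exact div_le_self (Real.exp_pos _).le h2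

/-- Writing `3t = (9/10)(10t/3)` buys geometric decay: one term of the series of `e^{10t/3}` is
below its sum, and `10/3 - 3 = 1/3` is the exponent left over. -/
lemma abs_rightFactor_le (q n : ℕ) {t : ℝ} (ht : 0 ≤ t) :
    |rightFactor q n t| ≤ (9 / 10) ^ n * weight q t := by
  have h := Real.pow_div_factorial_le_exp (10 / 3 * t) (by positivity) n
  have h3 : Real.exp (10 / 3 * t) * Real.exp (-(3 * t)) = Real.exp (t / 3) := by
    rw [← Real.exp_add]
    ring_nf
  rw [rightFactor, abs_of_nonneg (by positivity), weight, ← h3]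
  calc _ = (9 / 10) ^ n * (t ^ q * ((10 / 3 * t) ^ n / n.factorial * Real.exp (-(3 * t)))) := by
        rw [show 3 * t = 9 / 10 * (10 / 3 * t) by ring, mul_pow]
        ring
    _ ≤ _ := by gcongr

lemma hasSum_besselKernel (q : ℕ) {s t : ℝ} (hs : 0 < s) (ht : 0 < t) :
    HasSum (fun n => leftFactor q n s * rightFactor q n t) (besselKernel q s t) := by
  rw [besselKernel_eq q hs ht]
  refine ((hasSum_besselF_laguerre (2 * q + 1) s t).mul_left ((s * t) ^ q)).congr_fun fun n => ?_
  have h1 : (0 : ℝ) < n.factorial := by exact_mod_cast Nat.factorial_pos n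
  unfold leftFactor rightFactor
  rw [mul_pow s t q]
  field_simp

lemma abs_factors_le (q n : ℕ) {s t : ℝ} (hs : 0 ≤ s) (ht : 0 ≤ t) :
    |leftFactor q n s * rightFactor q n t| ≤ (9 / 10) ^ n * (weight q s * weight q t) := by
  rw [abs_mul, mul_left_comm]
  exact mul_le_mul (abs_leftFactor_le q n hs) (abs_rightFactor_le q n ht) (abs_nonneg _)
    (weight_nonneg q hs)

lemma abs_besselKernel_le (q : ℕ) {s t : ℝ} (hs : 0 < s) (ht : 0 < t) :
    |besselKernel q s t| ≤ 10 * (weight q s * weight q t) := by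
  -- The factor 10 in the bound is `1 / (1 - 9/10)`.
  have hg := (hasSum_geometric_of_lt_one (r := 9 / 10) (by norm_num) (by norm_num)).mul_right
    (weight q s * weight q t)
  norm_num at hg
  rw [← (hasSum_besselKernel q hs ht).tsum_eq]
  exact tsum_of_norm_bounded (f := fun n => leftFactor q n s * rightFactor q n t) hg fun n =>
    abs_factors_le q n hs.le ht.le

/-- The squared weight grows like `e^{2t/3}`, up to powers, and the measure integrates every
exponent below 1. -/
lemma memLp_weight (q : ℕ) : MemLp (weight q) 2 mMeas := by
  rw [memLp_two_iff_integrable_sq (measurable_weight q).aestronglyMeasurable]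
  refine (integrable_pow_mul_exp (2 * q) (c := 2 / 3) (by norm_num)).congr (.of_forall fun t => ?_)
  simp only [weight, mul_pow]
  rw [← Real.exp_nat_mul, ← pow_mul, mul_comm q 2]
  congr 2
  push_cast
  ring

/-! ### Rank one expansions -/

/-- Norm convergence gives convergence in measure, hence almost everywhere along a subsequence of
the partial sums; that limit must be the pointwise sum. -/
lemma ae_eq_of_hasSum_Lp {f : ℕ → L2m} {F : L2m} {g : ℝ → ℂ} (h : HasSum f F)
    (hg : ∀ᵐ t ∂mMeas, HasSum (fun n => f n t) (g t)) : F =ᵐ[mMeas] g := by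
  obtain ⟨ns, hns, hlim⟩ :=
    (tendstoInMeasure_of_tendsto_Lp h.tendsto_sum_nat).exists_seq_tendsto_ae
  have hsum : ∀ᵐ t ∂mMeas, ∀ N : ℕ,
      (∑ n ∈ Finset.range N, f n : L2m) t = ∑ n ∈ Finset.range N, f n t := by
    rw [ae_all_iff]
    intro N
    filter_upwards [Lp.coeFn_finsetSum (Finset.range N) f] with t ht
    rw [ht, Finset.sum_apply]
  filter_upwards [hlim, hg, hsum] with t h1 h2 h3
  simp only [h3] at h1
  exact tendsto_nhds_unique h1 (h2.tendsto_sum_nat.comp hns.tendsto_atTop)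

lemma isTraceClass_of_hasSum {H : Type*} [NormedAddCommGroup H] [InnerProductSpace ℂ H]
    {a b : ℕ → H} {T : H →L[ℂ] H} (hs : Summable fun n => ‖a n‖ * ‖b n‖)
    (hT : HasSum (fun n => InnerProductSpace.rankOne ℂ (b n) (a n)) T) : IsTraceClass T :=
  ⟨a, b, hs, fun x => by
    simpa using hT.mapL (ContinuousLinearMap.apply ℂ H x)⟩

lemma memLp_ofReal_weight (q : ℕ) : MemLp (fun t => (weight q t : ℂ)) 2 mMeas :=
  (memLp_weight q).ofReal

lemma memLp_leftFactor (q n : ℕ) : MemLp (fun t => (leftFactor q n t : ℂ)) 2 mMeas := by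
  have hm := (measurable_leftFactor q n).complex_ofReal
  refine (memLp_weight q).of_le hm.aestronglyMeasurable ?_
  filter_upwards [ae_mMeas_pos] with t ht
  rw [Complex.norm_real, Real.norm_eq_abs, Real.norm_of_nonneg (weight_nonneg q ht.le)]
  exact abs_leftFactor_le q n ht.le

lemma memLp_rightFactor (q n : ℕ) : MemLp (fun t => (rightFactor q n t : ℂ)) 2 mMeas := by
  have hm := (measurable_rightFactor q n).complex_ofReal
  refine ((memLp_weight q).const_mul ((9 / 10) ^ n)).of_le hm.aestronglyMeasurable ?_
  filter_upwards [ae_mMeas_pos] with t ht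
  rw [Complex.norm_real, Real.norm_eq_abs,
    Real.norm_of_nonneg (mul_nonneg (by positivity) (weight_nonneg q ht.le))]
  exact abs_rightFactor_le q n ht.le

/-- The weight, as an element of `L₂(m)`. -/
def weightLp (q : ℕ) : L2m := (memLp_ofReal_weight q).toLp _

/-- The left factors, as elements of `L₂(m)`. -/
def leftLp (q n : ℕ) : L2m := (memLp_leftFactor q n).toLp _

/-- The right factors, as elements of `L₂(m)`. -/
def rightLp (q n : ℕ) : L2m := (memLp_rightFactor q n).toLp _

lemma norm_leftLp_le (q n : ℕ) : ‖leftLp q n‖ ≤ ‖weightLp q‖ := by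
  refine Lp.norm_le_norm_of_ae_le ?_
  filter_upwards [(memLp_leftFactor q n).coeFn_toLp, (memLp_ofReal_weight q).coeFn_toLp,
    ae_mMeas_pos] with t h1 h2 ht
  rw [leftLp, weightLp, h1, h2, Complex.norm_real, Complex.norm_real, Real.norm_eq_abs,
    Real.norm_of_nonneg (weight_nonneg q ht.le)]
  exact abs_leftFactor_le q n ht.le

lemma norm_rightLp_le (q n : ℕ) : ‖rightLp q n‖ ≤ (9 / 10) ^ n * ‖weightLp q‖ := by
  refine Lp.norm_le_mul_norm_of_ae_le_mul ?_
  filter_upwards [(memLp_rightFactor q n).coeFn_toLp, (memLp_ofReal_weight q).coeFn_toLp,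
    ae_mMeas_pos] with t h1 h2 ht
  rw [rightLp, weightLp, h1, h2, Complex.norm_real, Complex.norm_real, Real.norm_eq_abs,
    Real.norm_of_nonneg (weight_nonneg q ht.le)]
  exact abs_rightFactor_le q n ht.le

lemma summable_norm_factors (q : ℕ) : Summable fun n => ‖leftLp q n‖ * ‖rightLp q n‖ := by
  have hg := (summable_geometric_of_lt_one (r := (9 / 10 : ℝ)) (by norm_num)
    (by norm_num)).mul_left (‖weightLp q‖ * ‖weightLp q‖)
  refine hg.of_nonneg_of_le (fun n => by positivity) fun n => ?_
  calc _ ≤ ‖weightLp q‖ * ((9 / 10) ^ n * ‖weightLp q‖) :=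
        mul_le_mul (norm_leftLp_le q n) (norm_rightLp_le q n) (norm_nonneg _) (norm_nonneg _)
    _ = _ := by ring

/-! ### The Bessel operator -/

/-- The integral operator with kernel `J_{2q+1}(2√(st))/√(st)`, as a sum of operators of
rank one. -/
def besselOp (q : ℕ) : L2m →L[ℂ] L2m :=
  ∑' n, InnerProductSpace.rankOne ℂ (rightLp q n) (leftLp q n)

lemma hasSum_besselOp (q : ℕ) :
    HasSum (fun n => InnerProductSpace.rankOne ℂ (rightLp q n) (leftLp q n)) (besselOp q) := by
  refine (Summable.of_norm ?_).hasSum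
  simpa [InnerProductSpace.norm_rankOne, mul_comm] using summable_norm_factors q

lemma inner_leftLp (q n : ℕ) (φ : L2m) :
    inner ℂ (leftLp q n) φ = ∫ s, (leftFactor q n s : ℂ) * φ s ∂mMeas := by
  rw [L2.inner_def]
  refine integral_congr_ae ?_
  filter_upwards [(memLp_leftFactor q n).coeFn_toLp] with s hs
  rw [leftLp, hs, RCLike.inner_apply, Complex.conj_ofReal, mul_comm]

lemma integrable_weight_mul (q : ℕ) (φ : L2m) :
    Integrable (fun s => weight q s * ‖φ s‖) mMeas :=
  (memLp_weight q).integrable_mul (Lp.memLp φ).norm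

lemma norm_besselKernel_mul_le (q : ℕ) (φ : L2m) {s t : ℝ} (hs : 0 < s) (ht : 0 < t) :
    ‖(besselKernel q s t : ℂ) * φ s‖ ≤ 10 * weight q t * (weight q s * ‖φ s‖) := by
  rw [norm_mul, Complex.norm_real, Real.norm_eq_abs]
  calc _ ≤ 10 * (weight q s * weight q t) * ‖φ s‖ := by
        gcongr
        exact abs_besselKernel_le q hs ht
    _ = _ := by ring

lemma aestronglyMeasurable_besselKernel (q : ℕ) :
    AEStronglyMeasurable (fun p : ℝ × ℝ => besselKernel q p.2 p.1) (mMeas.prod mMeas) := by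
  have hF := measurable_besselF (2 * q + 1)
  have hm : Measurable fun p : ℝ × ℝ => (p.2 * p.1) ^ q * besselF (2 * q + 1) (p.2 * p.1) := by
    fun_prop
  refine hm.aestronglyMeasurable.congr ?_
  have h1 : ∀ᵐ p : ℝ × ℝ ∂(mMeas.prod mMeas), 0 < p.1 := Measure.quasiMeasurePreserving_fst.ae
    ae_mMeas_pos
  have h2 : ∀ᵐ p : ℝ × ℝ ∂(mMeas.prod mMeas), 0 < p.2 := Measure.quasiMeasurePreserving_snd.ae
    ae_mMeas_pos
  filter_upwards [h1, h2] with p hp1 hp2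
  rw [besselKernel_eq q hp2 hp1]

lemma aestronglyMeasurable_besselKernel_left (q : ℕ) {t : ℝ} (ht : 0 < t) :
    AEStronglyMeasurable (fun s => besselKernel q s t) mMeas := by
  have hF := measurable_besselF (2 * q + 1)
  have hm : Measurable fun s : ℝ => (s * t) ^ q * besselF (2 * q + 1) (s * t) := by fun_prop
  refine hm.aestronglyMeasurable.congr ?_
  filter_upwards [ae_mMeas_pos] with s hs
  rw [besselKernel_eq q hs ht]

lemma integrable_besselKernel_mul (q : ℕ) (φ : L2m) {t : ℝ} (ht : 0 < t) :
    Integrable (fun s => (besselKernel q s t : ℂ) * φ s) mMeas := by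
  refine ((integrable_weight_mul q φ).const_mul (10 * weight q t)).mono'
    ((Complex.continuous_ofReal.comp_aestronglyMeasurable
      (aestronglyMeasurable_besselKernel_left q ht)).mul (Lp.aestronglyMeasurable φ)) ?_
  filter_upwards [ae_mMeas_pos] with s hs
  exact norm_besselKernel_mul_le q φ hs ht

/-- Identifies the abstract sum of rank one operators with the integral operator: for fixed `t`, sum
and integral are exchanged under the geometric bound on the factors. -/
lemma besselOp_apply (q : ℕ) (φ : L2m) :
    ∀ᵐ t ∂mMeas, besselOp q φ t = ∫ s, (besselKernel q s t : ℂ) * φ s ∂mMeas := by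
  have h := (hasSum_besselOp q).mapL (ContinuousLinearMap.apply ℂ L2m φ)
  simp only [ContinuousLinearMap.apply_apply, InnerProductSpace.rankOne_apply] at h
  refine ae_eq_of_hasSum_Lp h ?_
  have hterm : ∀ᵐ t ∂mMeas, ∀ n, (inner ℂ (leftLp q n) φ • rightLp q n : L2m) t =
      ∫ s, ((leftFactor q n s * rightFactor q n t : ℝ) : ℂ) * φ s ∂mMeas := by
    rw [ae_all_iff]
    intro n
    filter_upwards [Lp.coeFn_smul (inner ℂ (leftLp q n) φ) (rightLp q n),
      (memLp_rightFactor q n).coeFn_toLp] with t h1 h2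
    rw [h1, Pi.smul_apply, rightLp, h2, inner_leftLp, smul_eq_mul, ← integral_mul_const]
    congr 1
    funext s
    push_cast
    ring
  filter_upwards [hterm, ae_mMeas_pos] with t h1 ht
  simp only [h1]
  have hsum := (hasSum_geometric_of_lt_one (r := (9 / 10 : ℝ)) (by norm_num) (by norm_num))
  refine hasSum_integral_of_dominated_convergence
    (fun n s => (9 / 10) ^ n * (weight q t * (weight q s * ‖φ s‖))) (fun n => ?_) (fun n => ?_)
    (.of_forall fun s => hsum.summable.mul_right _) ?_ ?_
  · have := (measurable_leftFactor q n).complex_ofReal.aestronglyMeasurable (μ := mMeas)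
    simp only [Complex.ofReal_mul]
    exact (this.mul_const _).mul (Lp.aestronglyMeasurable φ)
  · filter_upwards [ae_mMeas_pos] with s hs
    rw [norm_mul, Complex.norm_real, Real.norm_eq_abs]
    calc _ ≤ (9 / 10) ^ n * (weight q s * weight q t) * ‖φ s‖ := by
          gcongr
          exact abs_factors_le q n hs.le ht.le
      _ = _ := by ring
  · simp only [tsum_mul_right]
    exact ((integrable_weight_mul q φ).const_mul _).const_mul _
  · filter_upwards [ae_mMeas_pos] with s hs
    exact (Complex.hasSum_ofReal.2 (hasSum_besselKernel q hs ht)).mul_right _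

/-! ### Multiplication operators -/

open Classical in
/-- Multiplication by an essentially bounded function (zero if the function is not essentially
bounded). -/
def mulOp (g : ℝ → ℂ) : L2m →L[ℂ] L2m :=
  if h : MemLp g ∞ mMeas then (ContinuousLinearMap.mul ℂ ℂ).holderL mMeas ∞ 2 2 (h.toLp g) else 0

lemma mulOp_apply {g : ℝ → ℂ} (h : MemLp g ∞ mMeas) (φ : L2m) :
    ∀ᵐ t ∂mMeas, mulOp g φ t = g t * φ t := by
  rw [mulOp, dif_pos h]
  have h1 := (ContinuousLinearMap.mul ℂ ℂ).coeFn_holder (r := 2) (h.toLp g) φ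
  filter_upwards [h1, h.coeFn_toLp] with t ht1 ht2
  change (ContinuousLinearMap.mul ℂ ℂ).holder 2 (h.toLp g) φ t = _
  rw [ht1, ht2]
  rfl

lemma sub_smul_mulM_apply (z : ℂ) (φ : L2m) :
    ∀ᵐ t ∂mMeas, (1 - z • mulM) φ t = (1 - z * Complex.exp (-(t : ℂ))) * φ t := by
  have h : (1 - z • mulM) φ = φ - z • mulM φ := rfl
  rw [h]
  filter_upwards [Lp.coeFn_sub φ (z • mulM φ), Lp.coeFn_smul z (mulM φ), mulM_apply φ]
    with t h1 h2 h3
  rw [h1, Pi.sub_apply, h2, Pi.smul_apply, h3, smul_eq_mul]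
  ring

/-- Rotating by half the argument of `u` places `a` and `c u` symmetrically about the real axis; the
left side is the real part of the rotated sum. -/
lemma cos_half_arg_mul_le (u : ℂ) {a c : ℝ} :
    Real.cos (u.arg / 2) * (a + c * ‖u‖) ≤ ‖(a : ℂ) + c * u‖ := by
  have h : ‖Complex.exp (((-(u.arg / 2) : ℝ) : ℂ) * Complex.I) * ((a : ℂ) + c * u)‖ =
      ‖(a : ℂ) + c * u‖ := by
    rw [norm_mul, Complex.norm_exp_ofReal_mul_I, one_mul]
  rw [← h]
  refine le_trans (le_of_eq ?_) (Complex.re_le_norm _)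
  have hu : Complex.exp (((-(u.arg / 2) : ℝ) : ℂ) * Complex.I) * ((a : ℂ) + c * u) =
      (a : ℂ) * Complex.exp (((-(u.arg / 2) : ℝ) : ℂ) * Complex.I) +
        ((c * ‖u‖ : ℝ) : ℂ) * Complex.exp (((u.arg / 2 : ℝ) : ℂ) * Complex.I) := by
    rw [show (((u.arg / 2 : ℝ) : ℂ) * Complex.I) =
      ((-(u.arg / 2) : ℝ) : ℂ) * Complex.I + u.arg * Complex.I by push_cast; ring,
      Complex.exp_add, Complex.ofReal_mul]
    linear_combination (-(Complex.exp (((-(u.arg / 2) : ℝ) : ℂ) * Complex.I) * c)) *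
      Complex.norm_mul_exp_arg_mul_I u
  rw [hu, Complex.add_re, Complex.re_ofReal_mul, Complex.re_ofReal_mul,
    Complex.exp_ofReal_mul_I_re, Complex.exp_ofReal_mul_I_re, Real.cos_neg]
  ring

lemma cos_half_arg_mul_le_norm_sub (z : ℂ) (t : ℝ) :
    -- The decomposition used is `1 - z e^{-t} = (1 - e^{-t}) + e^{-t} (1 - z)`.
    Real.cos ((1 - z).arg / 2) * ((1 - Real.exp (-t)) + Real.exp (-t) * ‖1 - z‖) ≤
      ‖1 - z * Complex.exp (-(t : ℂ))‖ := by
  refine (cos_half_arg_mul_le (1 - z)).trans (le_of_eq ?_)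
  congr 1
  push_cast
  ring

/-- The argument of `1 - z` is `π` only on the removed ray. The vertex `z = 1` causes no trouble,
since `arg 0 = 0`. -/
lemma arg_mem_of_mem_cutPlane {z : ℂ} (hz : z ∈ cutPlane) : |(1 - z).arg| < Real.pi := by
  refine lt_of_le_of_ne (Complex.abs_arg_le_pi _) fun h => hz ?_
  have : (1 - z).arg = Real.pi := by
    rcases abs_choice (1 - z).arg with h1 | h1
    · rw [← h1, h]
    · have := Complex.neg_pi_lt_arg (1 - z)
      linarith
  rw [Complex.arg_eq_pi_iff] at this
  simp at this
  exact this

lemma cos_half_arg_pos {z : ℂ} (hz : z ∈ cutPlane) : 0 < Real.cos ((1 - z).arg / 2) := by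
  have := abs_lt.1 (arg_mem_of_mem_cutPlane hz)
  exact Real.cos_pos_of_mem_Ioo ⟨by linarith, by linarith⟩

/-- The function `(1 - e^{-t}) / (1 - z e^{-t})`. -/
def multiplier (z : ℂ) (t : ℝ) : ℂ :=
  (1 - Complex.exp (-(t : ℂ))) / (1 - z * Complex.exp (-(t : ℂ)))

lemma measurable_multiplier (z : ℂ) : Measurable (multiplier z) := by
  unfold multiplier; fun_prop

lemma norm_one_sub_exp {t : ℝ} (ht : 0 < t) :
    ‖1 - Complex.exp (-(t : ℂ))‖ = 1 - Real.exp (-t) := by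
  have h : (1 : ℂ) - Complex.exp (-(t : ℂ)) = ((1 - Real.exp (-t) : ℝ) : ℂ) := by push_cast; rfl
  rw [h, Complex.norm_real, Real.norm_of_nonneg]
  have := Real.exp_lt_one_iff.2 (neg_lt_zero.2 ht)
  linarith

lemma sub_mul_exp_ne_zero {z : ℂ} (hz : z ∈ cutPlane) {t : ℝ} (ht : 0 < t) :
    1 - z * Complex.exp (-(t : ℂ)) ≠ 0 := by
  have h := cos_half_arg_mul_le_norm_sub z t
  have h1 := cos_half_arg_pos hz
  have h2 := Real.exp_lt_one_iff.2 (neg_lt_zero.2 ht)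
  have h3 : 0 < (1 - Real.exp (-t)) + Real.exp (-t) * ‖1 - z‖ := by
    have : 0 < 1 - Real.exp (-t) := by linarith
    positivity
  exact norm_pos_iff.1 ((mul_pos h1 h3).trans_le h)

/-- Dropping the term with `‖1 - z‖` from the lower bound on the denominator makes the estimate
uniform up to the vertex `z = 1`. -/
lemma norm_multiplier_le {z : ℂ} {κ : ℝ} (hκ : 0 < κ) (hz : κ ≤ Real.cos ((1 - z).arg / 2))
    {t : ℝ} (ht : 0 < t) : ‖multiplier z t‖ ≤ κ⁻¹ := by
  have h := cos_half_arg_mul_le_norm_sub z t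
  have h2 : 0 < 1 - Real.exp (-t) := by
    have := Real.exp_lt_one_iff.2 (neg_lt_zero.2 ht)
    linarith
  have h3 : κ * (1 - Real.exp (-t)) ≤ ‖1 - z * Complex.exp (-(t : ℂ))‖ := by
    refine le_trans (mul_le_mul hz ?_ h2.le (hκ.le.trans hz)) h
    have : 0 ≤ Real.exp (-t) * ‖1 - z‖ := by positivity
    linarith
  rw [multiplier, norm_div, norm_one_sub_exp ht, div_le_iff₀ ((mul_pos hκ h2).trans_le h3),
    inv_mul_eq_div, le_div_iff₀ hκ]
  linarith

lemma memLp_multiplier {z : ℂ} (hz : z ∈ cutPlane) : MemLp (multiplier z) ∞ mMeas := by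
  refine memLp_top_of_bound (measurable_multiplier z).aestronglyMeasurable
    (Real.cos ((1 - z).arg / 2))⁻¹ ?_
  filter_upwards [ae_mMeas_pos] with t ht
  exact norm_multiplier_le (cos_half_arg_pos hz) le_rfl ht

lemma memLp_inv_sub {z : ℂ} (hz : z ∈ cutPlane) (h1 : z ≠ 1) :
    MemLp (fun t : ℝ => (1 - z * Complex.exp (-(t : ℂ)))⁻¹) ∞ mMeas := by
  have hu : 0 < ‖1 - z‖ := norm_pos_iff.2 (sub_ne_zero.2 h1.symm)
  have hκ := cos_half_arg_pos hz
  have hm : 0 < min 1 ‖1 - z‖ := lt_min one_pos hu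
  refine memLp_top_of_bound (by fun_prop) (Real.cos ((1 - z).arg / 2) * min 1 ‖1 - z‖)⁻¹ ?_
  filter_upwards [ae_mMeas_pos] with t ht
  rw [norm_inv]
  refine inv_anti₀ (mul_pos hκ hm) (le_trans ?_ (cos_half_arg_mul_le_norm_sub z t))
  -- What remains is that a convex combination of 1 and `‖1 - z‖` is at least their minimum.
  gcongr
  have h2 := Real.exp_lt_one_iff.2 (neg_lt_zero.2 ht)
  have h3 := Real.exp_pos (-t)
  have h4 := min_le_left 1 ‖1 - z‖
  have h5 := min_le_right 1 ‖1 - z‖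
  nlinarith

lemma mulOp_inv_mul {z : ℂ} (hz : z ∈ cutPlane) (h1 : z ≠ 1) :
    mulOp (fun t : ℝ => (1 - z * Complex.exp (-(t : ℂ)))⁻¹) * (1 - z • mulM) = 1 ∧
    (1 - z • mulM) * mulOp (fun t : ℝ => (1 - z * Complex.exp (-(t : ℂ)))⁻¹) = 1 := by
  have hg := memLp_inv_sub hz h1
  constructor
  · ext1 φ
    refine Lp.ext ?_
    filter_upwards [mulOp_apply hg ((1 - z • mulM) φ), sub_smul_mulM_apply z φ, ae_mMeas_pos]
      with t e1 e2 ht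
    rw [mul_apply_eq_comp, e1, e2, one_apply_eq_self, ← mul_assoc,
      inv_mul_cancel₀ (sub_mul_exp_ne_zero hz ht), one_mul]
  · ext1 φ
    refine Lp.ext ?_
    filter_upwards [mulOp_apply hg φ, sub_smul_mulM_apply z
      (mulOp (fun t : ℝ => (1 - z * Complex.exp (-(t : ℂ)))⁻¹) φ), ae_mMeas_pos]
      with t e1 e2 ht
    rw [mul_apply_eq_comp, e2, e1, one_apply_eq_self, ← mul_assoc,
      mul_inv_cancel₀ (sub_mul_exp_ne_zero hz ht), one_mul]

lemma isUnit_sub_smul_mulM {z : ℂ} (hz : z ∈ cutPlane) (h1 : z ≠ 1) :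
    IsUnit (1 - z • mulM) :=
  ⟨⟨1 - z • mulM, _, (mulOp_inv_mul hz h1).2, (mulOp_inv_mul hz h1).1⟩, rfl⟩

lemma mulOp_multiplier_eq {z : ℂ} (hz : z ∈ cutPlane) (h1 : z ≠ 1) :
    mulOp (multiplier z) = (1 - mulM) * Ring.inverse (1 - z • mulM) := by
  rw [Ring.eq_mul_inverse_iff_mul_eq _ _ _ (isUnit_sub_smul_mulM hz h1)]
  ext1 φ
  refine Lp.ext ?_
  have h2 := sub_smul_mulM_apply 1 φ
  simp only [one_smul, one_mul] at h2
  filter_upwards [mulOp_apply (memLp_multiplier hz) ((1 - z • mulM) φ), sub_smul_mulM_apply z φ,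
    ae_mMeas_pos, h2] with t e1 e2 ht e3
  rw [mul_apply_eq_comp, e1, e2, e3, multiplier, ← mul_assoc,
    div_mul_cancel₀ _ (sub_mul_exp_ne_zero hz ht)]

/-! ### The Laplace transform of the Bessel kernel -/

lemma integrableOn_pow_mul_cexp (m : ℕ) {u : ℂ} (hu : 0 < u.re) :
    IntegrableOn (fun t : ℝ => (t : ℂ) ^ m * Complex.exp (-(t * u))) (Ioi 0) := by
  have h := integrableOn_rpow_mul_exp_neg_mul_rpow (s := m) (p := 1) (b := u.re)
    (by have : (0 : ℝ) ≤ m := Nat.cast_nonneg m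
        linarith) one_pos hu
  refine Integrable.mono' h (by fun_prop) ?_
  filter_upwards [ae_restrict_mem measurableSet_Ioi] with t ht
  have ht : 0 < t := ht
  rw [norm_mul, norm_pow, Complex.norm_real, Real.norm_of_nonneg ht.le, Complex.norm_exp,
    Real.rpow_natCast, Real.rpow_one]
  simp [mul_comm]

lemma tendsto_pow_mul_cexp (m : ℕ) {u : ℂ} (hu : 0 < u.re) :
    Tendsto (fun t : ℝ => (t : ℂ) ^ m * Complex.exp (-(t * u))) atTop (𝓝 0) := by
  rw [tendsto_zero_iff_norm_tendsto_zero]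
  have h := tendsto_rpow_mul_exp_neg_mul_atTop_nhds_zero m u.re hu
  refine h.congr' ?_
  filter_upwards [eventually_gt_atTop 0] with t ht
  rw [norm_mul, norm_pow, Complex.norm_real, Real.norm_of_nonneg ht.le, Complex.norm_exp,
    Real.rpow_natCast]
  simp [mul_comm]

lemma integral_pow_mul_cexp (m : ℕ) {u : ℂ} (hu : 0 < u.re) :
    ∫ t : ℝ in Ioi 0, (t : ℂ) ^ m * Complex.exp (-(t * u)) = m.factorial / u ^ (m + 1) := by
  have hu0 : u ≠ 0 := fun h => by simp [h] at hu
  have hexp : ∀ t : ℝ, HasDerivAt (fun t : ℝ => Complex.exp (-(t * u)))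
      (Complex.exp (-(t * u)) * (-u)) t := by
    intro t
    have := ((Complex.ofRealCLM.hasDerivAt (x := t)).mul_const u).neg.cexp
    simpa using this
  induction m with
  | zero =>
    have h := integral_Ioi_of_hasDerivAt_of_tendsto' (a := 0) (m := 0)
      (f := fun t : ℝ => Complex.exp (-(t * u)))
      (f' := fun t : ℝ => Complex.exp (-(t * u)) * (-u)) (fun t _ => hexp t)
      (by simpa [IntegrableOn] using (integrableOn_pow_mul_cexp 0 hu).mul_const (-u))
      (by simpa using tendsto_pow_mul_cexp 0 hu)
    rw [integral_mul_const] at h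
    simp at h ⊢
    field_simp
    rw [mul_comm, h]
  | succ m ih =>
    have hd : ∀ t : ℝ, HasDerivAt (fun t : ℝ => (t : ℂ) ^ (m + 1) * Complex.exp (-(t * u)))
        (((m + 1 : ℕ) : ℂ) * ((t : ℂ) ^ m * Complex.exp (-(t * u))) -
          u * ((t : ℂ) ^ (m + 1) * Complex.exp (-(t * u)))) t := by
      intro t
      have h1 := ((Complex.ofRealCLM.hasDerivAt (x := t)).pow (m + 1)).mul (hexp t)
      refine h1.congr_deriv ?_
      simp
      ring
    have i0 := (integrableOn_pow_mul_cexp m hu).const_mul ((m + 1 : ℕ) : ℂ)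
    have i1 := (integrableOn_pow_mul_cexp (m + 1) hu).const_mul u
    have h := integral_Ioi_of_hasDerivAt_of_tendsto' (a := 0) (fun t _ => hd t) (i0.sub i1)
      (tendsto_pow_mul_cexp (m + 1) hu)
    rw [integral_sub i0 i1, integral_const_mul, integral_const_mul, ih] at h
    simp only [Complex.ofReal_zero, ne_eq, Nat.add_eq_zero_iff, one_ne_zero, and_false,
      not_false_eq_true, zero_pow, zero_mul, sub_zero] at h
    rw [sub_eq_zero] at h
    refine mul_left_cancel₀ hu0 (h.symm.trans ?_)
    rw [Nat.factorial_succ, pow_succ u (m + 1)]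
    push_cast
    field_simp

/-- Taking the modulus replaces `u` by its real part. -/
lemma integral_norm_pow_mul_cexp (m : ℕ) {u : ℂ} (hu : 0 < u.re) :
    ∫ t : ℝ in Ioi 0, ‖(t : ℂ) ^ m * Complex.exp (-(t * u))‖ = m.factorial / u.re ^ (m + 1) := by
  have h := integral_pow_mul_cexp m (u := (u.re : ℂ)) (by simpa using hu)
  have h2 : ∫ t : ℝ in Ioi 0, (t : ℂ) ^ m * Complex.exp (-(t * (u.re : ℂ))) =
      ∫ t : ℝ in Ioi 0, ((‖(t : ℂ) ^ m * Complex.exp (-(t * u))‖ : ℝ) : ℂ) := by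
    refine setIntegral_congr_fun measurableSet_Ioi fun t ht => ?_
    have ht : 0 < t := ht
    simp only [norm_mul, norm_pow, Complex.norm_real, Real.norm_of_nonneg ht.le, Complex.norm_exp]
    push_cast
    simp
  rw [h2, integral_complex_ofReal] at h
  exact_mod_cast h

lemma integral_mMeas (g : ℝ → ℂ) :
    ∫ t, g t ∂mMeas = ∫ t in Ioi 0, ((t / (Real.exp t - 1) : ℝ) : ℂ) * g t := by
  have hm : Measurable (fun t : ℝ => ENNReal.ofReal (t / (Real.exp t - 1))) := by fun_prop
  rw [mMeas, integral_withDensity_eq_integral_toReal_smul hm (by simp)]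
  refine setIntegral_congr_fun measurableSet_Ioi fun t ht => ?_
  have ht : 0 < t := ht
  have h1 : 0 < Real.exp t - 1 := by
    have := Real.add_one_lt_exp ht.ne'
    linarith
  simp only [ENNReal.toReal_ofReal (div_pos ht h1).le, Complex.real_smul]

/-- The factor `e^t - 1` cancels the denominator of the density, leaving `t dt`. Integrating the
Bessel series termwise produces `(k + p)!`, which cancels the same factorial in the series and
leaves the exponential series of `-s/u`. -/
lemma integral_cexp_mul_besselKernel (q : ℕ) {s : ℝ} (hs : 0 < s) {u : ℂ} (hu : 0 < u.re) :
    ∫ t : ℝ, Complex.exp (-(t * u)) * (t : ℂ) ^ q * (Complex.exp t - 1) *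
      (besselKernel q s t : ℂ) ∂mMeas =
    (1 / u ^ 2) ^ (1 + q) * (Complex.exp (-(s * (1 / u))) * (s : ℂ) ^ q) := by
  have hu0 : u ≠ 0 := fun h => by simp [h] at hu
  set p := 2 * q + 1 with hp
  let c : ℕ → ℝ := fun k => (-1) ^ k / (k.factorial * (k + p).factorial) * s ^ (k + q)
  let F : ℕ → ℝ → ℂ := fun k t => (c k : ℂ) * ((t : ℂ) ^ (k + p) * Complex.exp (-(t * u)))
  have hfac : ∀ k : ℕ, (0 : ℝ) < k.factorial := fun k => by exact_mod_cast Nat.factorial_pos k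
  have hfacC : ∀ k : ℕ, (k.factorial : ℂ) ≠ 0 := fun k => by
    exact_mod_cast (Nat.factorial_pos k).ne'
  have hF : ∀ k, Integrable (F k) (volume.restrict (Ioi 0)) := fun k =>
    (integrableOn_pow_mul_cexp (k + p) hu).const_mul _
  have hnorm : ∀ k, ∫ t in Ioi 0, ‖F k t‖ =
      s ^ q / u.re ^ (p + 1) * ((s / u.re) ^ k / k.factorial) := by
    intro k
    simp only [F, norm_mul ((c k : ℂ))]
    rw [integral_const_mul, integral_norm_pow_mul_cexp _ hu, Complex.norm_real, Real.norm_eq_abs]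
    have h1 := hfac k
    have h2 := hfac (k + p)
    simp only [c, abs_mul, abs_div, abs_pow, abs_neg, abs_one, one_pow, abs_of_pos h1,
      abs_of_pos h2, abs_of_pos hs]
    rw [div_pow, show k + p + 1 = k + (p + 1) by ring, pow_add, pow_add]
    field_simp
  have hint : ∀ k, ∫ t in Ioi 0, F k t =
      s ^ q / u ^ (p + 1) * ((-(s * (1 / u))) ^ k / k.factorial) := by
    intro k
    simp only [F]
    rw [integral_const_mul, integral_pow_mul_cexp _ hu]
    have h1 := hfacC k
    have h2 := hfacC (k + p)
    simp only [c]
    push_cast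
    rw [neg_pow ((s : ℂ) * _), mul_pow, div_pow, one_pow, show k + p + 1 = k + (p + 1) by ring,
      pow_add, pow_add]
    field_simp
  have key := hasSum_integral_of_summable_integral_norm hF (by
    simp only [hnorm]
    exact (Real.summable_pow_div_factorial _).mul_left _)
  simp only [hint] at key
  have key2 := (NormedSpace.expSeries_div_hasSum_exp (-(s * (1 / u)))).mul_left
    ((s : ℂ) ^ q / u ^ (p + 1))
  rw [← Complex.exp_eq_exp_ℂ] at key2
  have hval := key.unique key2
  rw [integral_mMeas, show (1 / u ^ 2) ^ (1 + q) * (Complex.exp (-(s * (1 / u))) * (s : ℂ) ^ q) =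
    (s : ℂ) ^ q / u ^ (p + 1) * Complex.exp (-(s * (1 / u))) by
      rw [hp, div_pow, one_pow, ← pow_mul, show 2 * (1 + q) = 2 * q + 1 + 1 by ring]; ring, ← hval]
  refine setIntegral_congr_fun measurableSet_Ioi fun t ht => ?_
  have ht : 0 < t := ht
  have h1 : Complex.exp t - 1 ≠ 0 := by
    have := Real.add_one_lt_exp ht.ne'
    have h2 : Real.exp t - 1 ≠ 0 := by linarith
    exact_mod_cast h2
  have hk := (Complex.hasSum_ofReal.2 (hasSum_besselF p (s * t))).mul_left
    (Complex.exp (-(t * u)) * (t : ℂ) ^ (q + 1) * (s * t) ^ q)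
  rw [besselKernel_eq q hs ht]
  have hk2 : HasSum (fun k => F k t) (Complex.exp (-(t * u)) * (t : ℂ) ^ (q + 1) * (s * t) ^ q *
      besselF p (s * t)) := by
    refine hk.congr_fun fun k => ?_
    simp only [F, c, hp]
    push_cast
    ring
  rw [hk2.tsum_eq, pow_succ' (t : ℂ) q, ← hp]
  push_cast
  field_simp

lemma laplace_besselOp (q : ℕ) (φ : L2m) {u : ℂ} (hu : 1 / 2 < u.re) :
    ∫ t : ℝ, Complex.exp (-(t * u)) * (t : ℂ) ^ q * (Complex.exp t - 1) * besselOp q φ t ∂mMeas =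
    (1 / u ^ 2) ^ (1 + q) * ∫ s : ℝ, Complex.exp (-(s * (1 / u))) * (s : ℂ) ^ q * φ s ∂mMeas := by
  let f : ℝ → ℝ → ℂ := fun t s => Complex.exp (-(t * u)) * (t : ℂ) ^ q * (Complex.exp t - 1) *
    ((besselKernel q s t : ℂ) * φ s)
  have hf : Integrable (Function.uncurry f) (mMeas.prod mMeas) := by
    -- The exponent `4/3` is 1 from `e^t - 1` plus `1/3` from the weight; integrability only needs
    -- `Re u > 1/3`.
    have hA : Integrable (fun t => 10 * (t ^ (2 * q) * Real.exp ((4 / 3 - u.re) * t))) mMeas :=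
      (integrable_pow_mul_exp (2 * q) (by linarith)).const_mul _
    refine (hA.mul_prod (integrable_weight_mul q φ)).mono' ?_ ?_
    · have h0 : AEStronglyMeasurable (fun p : ℝ × ℝ => Complex.exp (-(p.1 * u)) * (p.1 : ℂ) ^ q *
          (Complex.exp p.1 - 1)) (mMeas.prod mMeas) := by fun_prop
      exact h0.mul ((Complex.continuous_ofReal.comp_aestronglyMeasurable
        (aestronglyMeasurable_besselKernel q)).mul (Lp.aestronglyMeasurable φ).comp_snd)
    · have h1 : ∀ᵐ p : ℝ × ℝ ∂(mMeas.prod mMeas), 0 < p.1 :=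
        Measure.quasiMeasurePreserving_fst.ae ae_mMeas_pos
      have h2 : ∀ᵐ p : ℝ × ℝ ∂(mMeas.prod mMeas), 0 < p.2 :=
        Measure.quasiMeasurePreserving_snd.ae ae_mMeas_pos
      filter_upwards [h1, h2] with p ht hs
      obtain ⟨t, s⟩ := p
      simp only [Function.uncurry, f] at ht hs ⊢
      rw [norm_mul]
      have hw := weight_nonneg q hs.le
      have hn : ‖Complex.exp t - 1‖ ≤ Real.exp t := by
        have e1 : Complex.exp t - 1 = ((Real.exp t - 1 : ℝ) : ℂ) := by push_cast; rfl
        have e2 := Real.add_one_lt_exp ht.ne'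
        rw [e1, Complex.norm_real, Real.norm_of_nonneg (by linarith)]
        linarith
      calc _ ≤ (Real.exp (-(t * u.re)) * t ^ q * Real.exp t) *
            (10 * weight q t * (weight q s * ‖φ s‖)) := by
            refine mul_le_mul ?_ (norm_besselKernel_mul_le q φ hs ht) (norm_nonneg _)
              (by positivity)
            rw [norm_mul, norm_mul, norm_pow, Complex.norm_real, Real.norm_of_nonneg ht.le,
              Complex.norm_exp]
            have e3 : (-(t * u)).re = -(t * u.re) := by simp
            rw [e3]
            gcongr
        _ = _ := by
            have e4 : Real.exp ((4 / 3 - u.re) * t) =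
                Real.exp (-(t * u.re)) * Real.exp t * Real.exp (t / 3) := by
              rw [← Real.exp_add, ← Real.exp_add]
              ring_nf
            rw [e4, weight]
            ring
  calc _ = ∫ t, ∫ s, f t s ∂mMeas ∂mMeas := by
        refine integral_congr_ae ?_
        filter_upwards [besselOp_apply q φ] with t ht
        rw [ht, ← integral_const_mul]
    _ = ∫ s, ∫ t, f t s ∂mMeas ∂mMeas := integral_integral_swap hf
    _ = ∫ s : ℝ, (1 / u ^ 2) ^ (1 + q) *
          (Complex.exp (-(s * (1 / u))) * (s : ℂ) ^ q * φ s) ∂mMeas := by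
        refine integral_congr_ae ?_
        filter_upwards [ae_mMeas_pos] with s hs
        simp only [f, ← mul_assoc]
        rw [integral_mul_const, integral_cexp_mul_besselKernel q hs (by linarith)]
        ring
    _ = _ := integral_const_mul _ _

/-! ### The transfer operator -/

/-- The operator `(-1)^q z (1 - M) (1 - z M)⁻¹ B_q` on `L₂(m)`. -/
def transferL2 (q : ℕ) (z : ℂ) : L2m →L[ℂ] L2m :=
  ((-1 : ℂ) ^ q * z) • (mulOp (multiplier z) * besselOp q)

lemma transferL2_apply (q : ℕ) {z : ℂ} (hz : z ∈ cutPlane) (φ : L2m) :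
    ∀ᵐ t ∂mMeas, transferL2 q z φ t = (-1 : ℂ) ^ q * z * multiplier z t * besselOp q φ t := by
  have h : transferL2 q z φ = ((-1 : ℂ) ^ q * z) • mulOp (multiplier z) (besselOp q φ) := rfl
  rw [h]
  filter_upwards [Lp.coeFn_smul ((-1 : ℂ) ^ q * z) (mulOp (multiplier z) (besselOp q φ)),
    mulOp_apply (memLp_multiplier hz) (besselOp q φ)] with t h1 h2
  rw [h1, Pi.smul_apply, h2, smul_eq_mul]
  ring

lemma mem_cutPlane_of_norm_le {z : ℂ} (hz : ‖z‖ ≤ 1) : z ∈ cutPlane := fun h =>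
  absurd ((Complex.re_le_norm z).trans hz) (not_le.2 h.1)

/-- A geometric series of ratio `z e^{-t}`, convergent on the whole closed disc because `t > 0`. -/
lemma hasSum_multiplier {z : ℂ} (hz : ‖z‖ ≤ 1) {t : ℝ} (ht : 0 < t) :
    HasSum (fun n : ℕ => z ^ (n + 1) * Complex.exp (-(t * (n + 1 : ℕ))) * (Complex.exp t - 1))
      (z * multiplier z t) := by
  have hlt : ‖z * Complex.exp (-(t : ℂ))‖ < 1 := by
    rw [norm_mul, Complex.norm_exp]
    have h1 : Real.exp (-(t : ℂ)).re < 1 := Real.exp_lt_one_iff.2 (by simpa using ht)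
    have h2 := Real.exp_pos (-(t : ℂ)).re
    nlinarith
  have h := (hasSum_geometric_of_norm_lt_one hlt).mul_left
    (z * (Complex.exp (-(t : ℂ)) * (Complex.exp t - 1)))
  have he : Complex.exp (-(t : ℂ)) * Complex.exp t = 1 := by rw [← Complex.exp_add]; simp
  rw [mul_sub, he, mul_one, mul_assoc, ← div_eq_mul_inv] at h
  refine h.congr_fun fun n => ?_
  have hn : Complex.exp (-(t * (n + 1 : ℕ))) = Complex.exp (-(t : ℂ)) ^ (n + 1) := by
    rw [← Complex.exp_nat_mul]
    congr 1
    ring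
  rw [hn, mul_pow]
  linear_combination (z ^ (n + 1) * Complex.exp (-(t : ℂ)) ^ n) * he

/-- Each branch is a Laplace integral of `besselOp q φ` by `laplace_besselOp` with `u = w + n + 1`;
the sum over branches is then taken under the integral. -/
lemma hasSum_laplace_transferL2 (q : ℕ) {z : ℂ} (hz : ‖z‖ ≤ 1) (φ : L2m) (w : HalfPlane) :
    HasSum (fun n : ℕ => (-1 : ℂ) ^ q * (z ^ (n + 1) *
      (1 / ((w : ℂ) + (n + 1 : ℕ)) ^ 2) ^ (1 + q) * laplaceEquiv q φ (branchC n w)))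
      (laplaceEquiv q (transferL2 q z φ) w) := by
  have hterm : ∀ n : ℕ, (-1 : ℂ) ^ q * (z ^ (n + 1) *
      (1 / ((w : ℂ) + (n + 1 : ℕ)) ^ 2) ^ (1 + q) * laplaceEquiv q φ (branchC n w)) =
      ∫ t : ℝ, (-1 : ℂ) ^ q * (z ^ (n + 1) * Complex.exp (-(t * (n + 1 : ℕ))) *
        (Complex.exp t - 1)) * (Complex.exp (-(t * (w : ℂ))) * (t : ℂ) ^ q *
          besselOp q φ t) ∂mMeas := by
    intro n
    have hu : 1 / 2 < ((w : ℂ) + (n + 1 : ℕ)).re := by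
      have := w.2
      have h0 : (0 : ℝ) ≤ n := Nat.cast_nonneg n
      simp
      linarith
    rw [laplaceEquiv_apply, branchC, mul_assoc (z ^ (n + 1)), ← laplace_besselOp q φ hu,
      ← mul_assoc, ← integral_const_mul]
    congr 1
    funext t
    rw [mul_add, neg_add, Complex.exp_add]
    ring
  simp only [hterm]
  rw [laplaceEquiv_apply]
  -- The case `z = 1` has nonnegative terms with sum 1, so it dominates every `z` in the closed
  -- disc.
  have hbound : ∀ᵐ t : ℝ ∂mMeas, HasSum (fun n : ℕ => ‖Complex.exp (-(t * (n + 1 : ℕ))) *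
      (Complex.exp t - 1)‖) 1 := by
    filter_upwards [ae_mMeas_pos] with t ht
    have h := hasSum_multiplier (z := 1) (by simp) ht
    have h1 : 0 < Real.exp t - 1 := by
      have := Real.add_one_lt_exp ht.ne'
      linarith
    have h2 : multiplier 1 t = 1 := by
      have := sub_mul_exp_ne_zero (mem_cutPlane_of_norm_le (z := 1) (by simp)) ht
      rw [one_mul] at this
      rw [multiplier, one_mul, div_self this]
    rw [h2] at h
    simp only [one_pow, one_mul] at h
    rw [← Complex.hasSum_ofReal, Complex.ofReal_one]
    refine h.congr_fun fun n => ?_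
    have e1 : Complex.exp (-(t * (n + 1 : ℕ))) * (Complex.exp t - 1) =
      ((Real.exp (-(t * (n + 1 : ℕ))) * (Real.exp t - 1) : ℝ) : ℂ) := by push_cast; rfl
    rw [e1, Complex.norm_real, Real.norm_of_nonneg (by positivity)]
  have hint := integrable_kernel q w (besselOp q φ)
  refine hasSum_integral_of_dominated_convergence
    (fun n t => ‖Complex.exp (-(t * (n + 1 : ℕ))) * (Complex.exp t - 1)‖ *
      ‖Complex.exp (-(t * (w : ℂ))) * (t : ℂ) ^ q * besselOp q φ t‖) (fun n => ?_)
    (fun n => ?_) ?_ ?_ ?_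
  · have h0 : AEStronglyMeasurable (fun t : ℝ => (-1 : ℂ) ^ q * (z ^ (n + 1) *
      Complex.exp (-(t * (n + 1 : ℕ))) * (Complex.exp t - 1))) mMeas := by fun_prop
    exact h0.mul hint.aestronglyMeasurable
  · refine .of_forall fun t => ?_
    rw [norm_mul _ (Complex.exp (-(t * (w : ℂ))) * (t : ℂ) ^ q * besselOp q φ t)]
    refine mul_le_mul_of_nonneg_right ?_ (norm_nonneg _)
    rw [mul_assoc, ← mul_assoc, norm_mul]
    refine mul_le_of_le_one_left (norm_nonneg _) ?_
    simp only [norm_mul, norm_pow, norm_neg, norm_one, one_pow, one_mul]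
    exact pow_le_one₀ (norm_nonneg _) hz
  · filter_upwards [hbound] with t h
    exact h.summable.mul_right _
  · refine hint.norm.congr ?_
    filter_upwards [hbound] with t h
    rw [tsum_mul_right, h.tsum_eq, one_mul]
  · filter_upwards [ae_mMeas_pos, transferL2_apply q (mem_cutPlane_of_norm_le hz) φ] with t ht h
    have h1 := ((hasSum_multiplier hz ht).mul_left ((-1 : ℂ) ^ q)).mul_right
      (Complex.exp (-(t * (w : ℂ))) * (t : ℂ) ^ q * besselOp q φ t)
    rw [h]
    convert! h1 using 1
    ring

lemma deriv_branch (n : ℕ) {x : ℝ} (hx : 0 < x) :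
    deriv (branch (n + 1)) x = -(1 / (x + (n + 1 : ℕ)) ^ 2) := by
  have h0 : x + (n + 1 : ℕ) ≠ 0 := by positivity
  have h := (((hasDerivAt_id x).add_const ((n + 1 : ℕ) : ℝ)).inv h0).deriv
  have hb : branch (n + 1) = (fun y => id y + ((n + 1 : ℕ) : ℝ))⁻¹ := by
    funext y
    simp [branch]
  rw [hb, h]
  simp [neg_div]

lemma passageTime_branch (n : ℕ) {x : ℝ} (hx : x ∈ Ioo (0 : ℝ) 1) :
    passageTime (branch (n + 1) x) = n + 1 := by
  have h0 := hx.1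
  have h1 := hx.2
  rw [passageTime, branch, one_div_one_div, Nat.floor_add_natCast h0.le,
    Nat.floor_eq_zero.2 h1, zero_add]

/-- On the unit interval the two series agree term by term, because the passage time of the n-th
branch is the constant `n`. -/
lemma isTransfer_of_hasSum {q : ℕ} {z : ℂ} {f g : HalfPlane → ℂ}
    (h : ∀ w : HalfPlane, HasSum (fun n : ℕ => (-1 : ℂ) ^ q * (z ^ (n + 1) *
      (1 / ((w : ℂ) + (n + 1 : ℕ)) ^ 2) ^ (1 + q) * f (branchC n w))) (g w)) :
    IsTransfer q z f g := by
  refine ⟨fun x hx => ?_, h⟩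
  refine (h (ofUnit x hx)).congr_fun fun n => ?_
  have hbr : ofUnit (branch (n + 1) x) (branch_mem n hx) = branchC n (ofUnit x hx) := by
    apply Subtype.ext
    simp [ofUnit, branchC, branch]
  rw [hbr, passageTime_branch n hx, deriv_branch n hx.1, abs_neg, abs_of_nonneg (by positivity)]
  simp [ofUnit]

/-! ### Dependence on the parameter -/

lemma isOpen_openCutPlane : IsOpen openCutPlane := by
  have h : IsClosed {z : ℂ | 1 ≤ z.re ∧ z.im = 0} :=
    (isClosed_le continuous_const Complex.continuous_re).inter
      (isClosed_eq Complex.continuous_im continuous_const)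
  exact h.isOpen_compl

lemma openCutPlane_subset {z : ℂ} (hz : z ∈ openCutPlane) : z ∈ cutPlane ∧ z ≠ 1 :=
  ⟨fun h => hz ⟨h.1.le, h.2⟩, fun h => hz (by simp [h])⟩

lemma mem_openCutPlane_of_ne {z : ℂ} (hz : z ∈ cutPlane) (h1 : z ≠ 1) : z ∈ openCutPlane := by
  rintro ⟨h2, h3⟩
  refine hz ⟨lt_of_le_of_ne h2 fun h => h1 (Complex.ext ?_ ?_), h3⟩ <;> simp [h3, ← h]

lemma mem_cutPlane_of_arg {z : ℂ} {θ : ℝ} (hθ : θ < Real.pi) (hz : |(1 - z).arg| ≤ θ) :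
    z ∈ cutPlane := by
  rintro ⟨h1, h2⟩
  have h : (1 - z).arg = Real.pi := by
    rw [Complex.arg_eq_pi_iff]
    simp [h1, h2]
  rw [h, abs_of_pos Real.pi_pos] at hz
  linarith

lemma transferL2_eq (q : ℕ) {z : ℂ} (hz : z ∈ cutPlane) (h1 : z ≠ 1) :
    transferL2 q z = ((-1 : ℂ) ^ q * z) •
      ((1 - mulM) * Ring.inverse (1 - z • mulM) * besselOp q) := by
  rw [transferL2, mulOp_multiplier_eq hz h1]

lemma differentiableOn_transferL2 (q : ℕ) :
    DifferentiableOn ℂ (transferL2 q) openCutPlane := by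
  have hd : DifferentiableOn ℂ (fun z : ℂ => ((-1 : ℂ) ^ q * z) •
      ((1 - mulM) * Ring.inverse (1 - z • mulM) * besselOp q)) openCutPlane := by
    intro z hz
    obtain ⟨hz1, hz2⟩ := openCutPlane_subset hz
    have h0 : DifferentiableAt ℂ (fun z : ℂ => (1 : L2m →L[ℂ] L2m) - z • mulM) z := by fun_prop
    have h1 : DifferentiableAt ℂ (fun z : ℂ => Ring.inverse ((1 : L2m →L[ℂ] L2m) - z • mulM)) z :=
      DifferentiableAt.comp (g := Ring.inverse) z
        (differentiableAt_inverse (isUnit_sub_smul_mulM hz1 hz2)) h0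
    have h2 : DifferentiableAt ℂ (fun z : ℂ => (-1 : ℂ) ^ q * z) z := by fun_prop
    exact (h2.smul ((h1.const_mul _).mul_const _)).differentiableWithinAt
  exact hd.congr fun z hz =>
    transferL2_eq q (openCutPlane_subset hz).1 (openCutPlane_subset hz).2

lemma tendsto_multiplier {t : ℝ} (ht : 0 < t) :
    Tendsto (fun z => multiplier z t) (𝓝 1) (𝓝 1) := by
  have h0 := sub_mul_exp_ne_zero (mem_cutPlane_of_norm_le (z := 1) (by simp)) ht
  have hc : ContinuousAt (fun z => multiplier z t) 1 := by
    unfold multiplier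
    exact continuousAt_const.div (by fun_prop) h0
  have h1 : multiplier 1 t = 1 := by
    rw [one_mul] at h0
    rw [multiplier, one_mul, div_self h0]
  simpa [ContinuousAt, h1] using hc

lemma norm_sq_eq_integral (f : L2m) : ‖f‖ ^ 2 = ∫ t, ‖f t‖ ^ 2 ∂mMeas := by
  have h := L2.inner_def (𝕜 := ℂ) f f
  simp only [inner_self_eq_norm_sq_to_K] at h
  have h2 : ∫ t, ((‖f t‖ : ℂ)) ^ 2 ∂mMeas = ((∫ t, ‖f t‖ ^ 2 ∂mMeas : ℝ) : ℂ) := by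
    rw [← integral_complex_ofReal]
    simp
  have h3 : (‖f‖ : ℂ) ^ 2 = ((∫ t, ‖f t‖ ^ 2 ∂mMeas : ℝ) : ℂ) := h.trans h2
  exact_mod_cast h3

lemma cos_half_le_of_abs_arg_le {θ : ℝ} (hθ : θ < Real.pi) {z : ℂ} (hz : |(1 - z).arg| ≤ θ) :
    Real.cos (θ / 2) ≤ Real.cos ((1 - z).arg / 2) := by
  rw [← Real.cos_abs ((1 - z).arg / 2), abs_div, abs_two]
  refine Real.cos_le_cos_of_nonneg_of_le_pi (by positivity) (by linarith [Real.pi_pos])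
    (by linarith)

lemma norm_mulOp_multiplier_le {z : ℂ} (hz : z ∈ cutPlane) {κ : ℝ} (hκ : 0 < κ)
    (h : κ ≤ Real.cos ((1 - z).arg / 2)) (φ : L2m) :
    ‖mulOp (multiplier z) φ‖ ≤ κ⁻¹ * ‖φ‖ := by
  refine Lp.norm_le_mul_norm_of_ae_le_mul ?_
  filter_upwards [mulOp_apply (memLp_multiplier hz) φ, ae_mMeas_pos] with t h1 ht
  rw [h1, norm_mul]
  gcongr
  exact norm_multiplier_le hκ h ht

/-- Dominated convergence, using the uniform bound on the sector. Only strong convergence is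
possible: for `z ≠ 1` the multiplier tends to 0 as `t → 0`. -/
lemma tendsto_mulOp_multiplier {θ : ℝ} (h0 : 0 ≤ θ) (hθ : θ < Real.pi) (φ : L2m) :
    Tendsto (fun z => mulOp (multiplier z) φ) (𝓝[{z : ℂ | |(1 - z).arg| ≤ θ}] 1) (𝓝 φ) := by
  have hκ : 0 < Real.cos (θ / 2) := Real.cos_pos_of_mem_Ioo ⟨by linarith, by linarith⟩
  set κ := Real.cos (θ / 2) with hκdef
  have hS : ∀ᶠ z in 𝓝[{z : ℂ | |(1 - z).arg| ≤ θ}] 1, |(1 - z).arg| ≤ θ :=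
    eventually_mem_nhdsWithin
  have hsq : Tendsto (fun z => ∫ t, ‖multiplier z t - 1‖ ^ 2 * ‖φ t‖ ^ 2 ∂mMeas)
      (𝓝[{z : ℂ | |(1 - z).arg| ≤ θ}] 1) (𝓝 (∫ _ : ℝ, (0 : ℝ) ∂mMeas)) := by
    have hφ := (Lp.memLp φ).norm
    refine tendsto_integral_filter_of_dominated_convergence
      (fun t => (κ⁻¹ + 1) ^ 2 * ‖φ t‖ ^ 2) ?_ ?_ ?_ ?_
    · refine .of_forall fun z => ?_
      have h1 := (measurable_multiplier z).aestronglyMeasurable (μ := mMeas)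
      exact ((h1.sub aestronglyMeasurable_const).norm.pow 2).mul (hφ.aestronglyMeasurable.pow 2)
    · filter_upwards [hS] with z hz
      filter_upwards [ae_mMeas_pos] with t ht
      rw [Real.norm_of_nonneg (by positivity)]
      gcongr
      refine (norm_sub_le _ _).trans ?_
      rw [norm_one]
      gcongr
      exact norm_multiplier_le hκ (cos_half_le_of_abs_arg_le hθ hz) ht
    · exact ((memLp_two_iff_integrable_sq_norm (Lp.aestronglyMeasurable φ)).1
        (Lp.memLp φ)).const_mul _
    · filter_upwards [ae_mMeas_pos] with t ht
      have h1 := (((tendsto_multiplier ht).sub_const 1).norm.pow 2).mul_const (‖φ t‖ ^ 2)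
      simp only [sub_self, norm_zero, ne_eq, OfNat.ofNat_ne_zero, not_false_eq_true, zero_pow,
        zero_mul] at h1
      exact h1.mono_left nhdsWithin_le_nhds
  rw [integral_zero] at hsq
  rw [tendsto_iff_norm_sub_tendsto_zero]
  have hn : Tendsto (fun z => ‖mulOp (multiplier z) φ - φ‖ ^ 2)
      (𝓝[{z : ℂ | |(1 - z).arg| ≤ θ}] 1) (𝓝 0) := by
    refine hsq.congr' ?_
    filter_upwards [hS] with z hz
    rw [norm_sq_eq_integral]
    refine integral_congr_ae ?_
    filter_upwards [Lp.coeFn_sub (mulOp (multiplier z) φ) φ,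
      mulOp_apply (memLp_multiplier (mem_cutPlane_of_arg hθ hz)) φ] with t h1 h2
    rw [h1, Pi.sub_apply, h2, ← sub_one_mul, norm_mul, mul_pow]
  have := hn.sqrt
  simpa using this

lemma mulOp_multiplier_one (φ : L2m) : mulOp (multiplier 1) φ = φ := by
  refine Lp.ext ?_
  have hz : (1 : ℂ) ∈ cutPlane := mem_cutPlane_of_norm_le (by simp)
  filter_upwards [mulOp_apply (memLp_multiplier hz) φ, ae_mMeas_pos] with t h1 ht
  have h0 := sub_mul_exp_ne_zero hz ht
  rw [one_mul] at h0
  rw [h1, multiplier, one_mul, div_self h0, one_mul]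

lemma tendsto_rankOne_left {ι H : Type*} [NormedAddCommGroup H] [InnerProductSpace ℂ H]
    {l : Filter ι} {b : ι → H} {b₀ : H} (h : Tendsto b l (𝓝 b₀)) (a : H) :
    Tendsto (fun i => InnerProductSpace.rankOne ℂ (b i) a) l
      (𝓝 (InnerProductSpace.rankOne ℂ b₀ a)) := by
  rw [tendsto_iff_norm_sub_tendsto_zero] at h ⊢
  have h1 := h.mul_const ‖a‖
  rw [zero_mul] at h1
  refine h1.congr fun i => ?_
  rw [← InnerProductSpace.norm_rankOne (𝕜 := ℂ), map_sub, sub_apply]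

lemma hasSum_mul_besselOp (q : ℕ) (T : L2m →L[ℂ] L2m) :
    HasSum (fun n => InnerProductSpace.rankOne ℂ (T (rightLp q n)) (leftLp q n))
      (T * besselOp q) := by
  refine ((hasSum_besselOp q).mul_left T).congr_fun fun n => ?_
  ext1 φ
  simp [mul_apply_eq_comp]

/-- Strong convergence becomes norm convergence on each rank one term, and dominated convergence for
series passes it to the nuclear sum. -/
lemma tendsto_transferL2 (q : ℕ) {θ : ℝ} (h0 : 0 ≤ θ) (hθ : θ < Real.pi) :
    Tendsto (transferL2 q) (𝓝[{z : ℂ | |(1 - z).arg| ≤ θ}] 1) (𝓝 (transferL2 q 1)) := by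
  have hκ : 0 < Real.cos (θ / 2) := Real.cos_pos_of_mem_Ioo ⟨by linarith, by linarith⟩
  have hsum : Tendsto (fun z => mulOp (multiplier z) * besselOp q)
      (𝓝[{z : ℂ | |(1 - z).arg| ≤ θ}] 1) (𝓝 (mulOp (multiplier 1) * besselOp q)) := by
    simp only [← (hasSum_mul_besselOp q _).tsum_eq]
    refine tendsto_tsum_of_dominated_convergence
      ((summable_norm_factors q).mul_left (Real.cos (θ / 2))⁻¹) (fun n => ?_) ?_
    · rw [mulOp_multiplier_one]
      exact tendsto_rankOne_left (tendsto_mulOp_multiplier h0 hθ (rightLp q n)) _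
    · filter_upwards [eventually_mem_nhdsWithin] with z hz n
      rw [InnerProductSpace.norm_rankOne, mul_left_comm, mul_comm]
      gcongr
      exact norm_mulOp_multiplier_le (mem_cutPlane_of_arg hθ hz) hκ
        (cos_half_le_of_abs_arg_le hθ hz) _
  have hz : Tendsto (fun z : ℂ => (-1 : ℂ) ^ q * z) (𝓝[{z : ℂ | |(1 - z).arg| ≤ θ}] 1)
      (𝓝 ((-1 : ℂ) ^ q * 1)) :=
    ((continuous_const.mul continuous_id).tendsto 1).mono_left nhdsWithin_le_nhds
  exact hz.smul hsum

lemma continuousOn_transferL2 (q : ℕ) {θ : ℝ} (hθ : θ < Real.pi) :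
    ContinuousOn (transferL2 q) {z : ℂ | |(1 - z).arg| ≤ θ} := by
  intro z hz
  rcases eq_or_ne z 1 with rfl | h1
  · exact tendsto_transferL2 q ((abs_nonneg _).trans hz) hθ
  · have hm := mem_openCutPlane_of_ne (mem_cutPlane_of_arg hθ hz) h1
    exact ((differentiableOn_transferL2 q).differentiableAt
      (isOpen_openCutPlane.mem_nhds hm)).continuousAt.continuousWithinAt

lemma hasSum_transferL2 (q : ℕ) (z : ℂ) :
    HasSum (fun n => InnerProductSpace.rankOne ℂ
      ((((-1 : ℂ) ^ q * z) • mulOp (multiplier z)) (rightLp q n)) (leftLp q n))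
      (transferL2 q z) := by
  rw [transferL2, ← smul_mul_assoc]
  exact hasSum_mul_besselOp q _

lemma summable_norm_transferL2 (q : ℕ) (T : L2m →L[ℂ] L2m) :
    Summable fun n => ‖leftLp q n‖ * ‖T (rightLp q n)‖ := by
  refine ((summable_norm_factors q).mul_left ‖T‖).of_nonneg_of_le (fun n => by positivity)
    fun n => ?_
  rw [mul_left_comm]
  gcongr
  exact T.le_opNorm _

/-! ### Transport to the space `H_{1,q}` -/

/-- Conjugation of operators on `L₂(m)` with `L_q`. -/
def laplaceConj (q : ℕ) : (L2m →L[ℂ] L2m) ≃L[ℂ] (H1 q →L[ℂ] H1 q) :=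
  (laplaceEquiv q).toContinuousLinearEquiv.arrowCongr (laplaceEquiv q).toContinuousLinearEquiv

lemma laplaceConj_apply (q : ℕ) (T : L2m →L[ℂ] L2m) (f : H1 q) :
    laplaceConj q T f = laplaceEquiv q (T ((laplaceEquiv q).symm f)) := rfl

/-- Unitarity of `L_q` carries a nuclear expansion to `H_{1,q}` with the same norms. -/
lemma laplaceConj_rankOne (q : ℕ) (a b : L2m) :
    laplaceConj q (InnerProductSpace.rankOne ℂ b a) =
      InnerProductSpace.rankOne ℂ (laplaceEquiv q b) (laplaceEquiv q a) := by
  ext1 f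
  rw [laplaceConj_apply, InnerProductSpace.rankOne_apply, InnerProductSpace.rankOne_apply,
    map_smul, LinearIsometryEquiv.inner_map_eq_flip]

lemma isTraceClass_transferL2 (q : ℕ) (z : ℂ) : IsTraceClass (transferL2 q z) :=
  isTraceClass_of_hasSum (summable_norm_transferL2 q _) (hasSum_transferL2 q z)

lemma isTraceClass_laplaceConj_transferL2 (q : ℕ) (z : ℂ) :
    IsTraceClass (laplaceConj q (transferL2 q z)) := by
  have h := (hasSum_transferL2 q z).mapL (laplaceConj q).toContinuousLinearMap
  simp only [ContinuousLinearEquiv.coe_coe, laplaceConj_rankOne] at h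
  refine isTraceClass_of_hasSum ?_ h
  simpa only [LinearIsometryEquiv.norm_map] using summable_norm_transferL2 q _

end FareyGauss

end

theorem mainTheorem12 (q : ℕ) :
    ∃ (B : FareyGauss.L2m →L[ℂ] FareyGauss.L2m)
      (K : ℂ → FareyGauss.L2m →L[ℂ] FareyGauss.L2m)
      (Q : ℂ → FareyGauss.H1 q →L[ℂ] FareyGauss.H1 q),
      -- `B` is the integral operator with kernel `J_{2q+1}(2√(st))/√(st)`
      (∀ φ : FareyGauss.L2m, ∀ᵐ t ∂FareyGauss.mMeas,
        Integrable (fun s : ℝ => (FareyGauss.besselKernel q s t : ℂ) * φ s) FareyGauss.mMeas ∧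
        B φ t = ∫ s : ℝ, (FareyGauss.besselKernel q s t : ℂ) * φ s ∂FareyGauss.mMeas) ∧
      -- `K z = (-1)^q z (1 - M) (1 - z M)⁻¹ B`, operatorially and pointwise
      (∀ z ∈ FareyGauss.cutPlane, z ≠ 1 →
        IsUnit (1 - z • FareyGauss.mulM) ∧
        K z = ((-1 : ℂ) ^ q * z) •
          ((1 - FareyGauss.mulM) * Ring.inverse (1 - z • FareyGauss.mulM) * B)) ∧
      (∀ z ∈ FareyGauss.cutPlane, ∀ φ : FareyGauss.L2m, ∀ᵐ t ∂FareyGauss.mMeas,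
        K z φ t = (-1 : ℂ) ^ q * z *
          ((1 - Complex.exp (-(t : ℂ))) / (1 - z * Complex.exp (-(t : ℂ)))) * B φ t) ∧
      -- `Q z` is the transfer operator `Q_{z,q}` wherever its power series converges
      (∀ z : ℂ, ‖z‖ ≤ 1 → ∀ f : FareyGauss.H1 q, FareyGauss.IsTransfer q z f (Q z f)) ∧
      -- `z ↦ Q z` is the analytic continuation to the cut plane
      AnalyticOnNhd ℂ Q FareyGauss.openCutPlane ∧
      (∀ θ : ℝ, θ < Real.pi → ContinuousOn Q {z : ℂ | |(1 - z).arg| ≤ θ}) ∧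
      -- conjugacy and trace class property
      (∀ z ∈ FareyGauss.cutPlane,
        (∀ φ : FareyGauss.L2m,
          Q z (FareyGauss.laplaceEquiv q φ) = FareyGauss.laplaceEquiv q (K z φ)) ∧
        FareyGauss.IsTraceClass (Q z) ∧ FareyGauss.IsTraceClass (K z)) := by
  open FareyGauss in
  refine ⟨besselOp q, transferL2 q, fun z => laplaceConj q (transferL2 q z), fun φ => ?_,
    fun z hz h1 => ⟨isUnit_sub_smul_mulM hz h1, transferL2_eq q hz h1⟩,
    fun z hz φ => transferL2_apply q hz φ, fun z hz f => ?_, ?_, fun θ hθ => ?_,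
    fun z _ => ⟨fun φ => ?_, isTraceClass_laplaceConj_transferL2 q z,
      isTraceClass_transferL2 q z⟩⟩
  · filter_upwards [FareyGauss.ae_mMeas_pos, FareyGauss.besselOp_apply q φ] with t ht h
    exact ⟨FareyGauss.integrable_besselKernel_mul q φ ht, h⟩
  · obtain ⟨φ, rfl⟩ := (FareyGauss.laplaceEquiv q).surjective f
    rw [FareyGauss.laplaceConj_apply, LinearIsometryEquiv.symm_apply_apply]
    exact FareyGauss.isTransfer_of_hasSum (FareyGauss.hasSum_laplace_transferL2 q hz φ)
  -- Complex differentiability on an open set already gives analyticity in operator norm.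
  · exact ((FareyGauss.laplaceConj q).differentiable.comp_differentiableOn
      (FareyGauss.differentiableOn_transferL2 q)).analyticOnNhd FareyGauss.isOpen_openCutPlane
  · exact (FareyGauss.laplaceConj q).continuous.comp_continuousOn
      (FareyGauss.continuousOn_transferL2 q hθ)
  · rw [FareyGauss.laplaceConj_apply, LinearIsometryEquiv.symm_apply_apply]
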